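/- Let $H\in(0,1)$ and $\theta>0$. A fractional Brownian motion with Hurst parameter $H$ is a centered Gaussian process $B^H=\{B^H_t,\ t\in\mathbb R\}$ with almost surely continuous paths and $$E\left(B^H_tB^H_s\right)=\tfrac12\left(|t|^{2H}+|s|^{2H}-|t-s|^{2H}\right),\qquad s,t\in\mathbb R.$$ Given such a process, put $$X^H_t=e^{-\theta t}\int_0^t e^{\theta s}\,dB^H_s\quad(t\ge 0),\qquad Z^H_t=\int_{-\infty}^t e^{-\theta(t-s)}\,dB^H_s\quad(t\in\mathbb R),$$ where the integrals are pathwise Riemann–Stieltjes integrals (the second one improper at $-\infty$). Almost surely, these integrals exist for all such $t$, and $X^H_t$ and $Z^H_t$ have finite moments of all orders. Moreover: (i) $Z^H$ is an ergodic stationary Gaussian process. (Ergodic means: every event $\{Z^H\in A\}$, with $A$ in the product $\sigma$-algebra of $\mathbb R^{\mathbb R}$, that is invariant up to null sets under every time shift has probability $0$ or $1$.) (ii) For every integer $p\ge1$ there is a constant $C>0$ depending only on $\theta$, $H$ and $p$ such that: if $p$ is even, then $$\left|E\left[(X^H_t)^p\right]-E\left[(Z^H_0)^p\right]\right|\le Ce^{-\theta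 t}\quad\text{for all }t\ge0,\qquad E\left[(Z^H_0)^p\right]=\frac{p!}{2^{p/2}\,(p/2)!}\left(\frac{H\,\Gamma(2H)}{\theta^{2H}}\right)^{p/2};$$ if $p$ is odd, then $E\left[(X^H_t)^p\right]=E\left[(Z^H_0)^p\right]=0$ for all $t\ge0$. (iii) If $H\ne\frac12$, then $$E\left(Z^H_tZ^H_0\right)\sim \frac{H(2H-1)}{\theta^2}\,t^{2H-2}\quad\text{as }t\to\infty,$$ that is, the ratio of the two sides tends to $1$. If $H=\frac12$, then $E\left(Z^H_tZ^H_0\right)=\frac{e^{-\theta t}}{2\theta}$ for all $t\ge0$. (iv) There is a constant $C>0$ depending only on $\theta$ and $H$ such that, for all $s,t\ge0$ with $|t-s|>2$: if $H\neq\frac12$, then $E\left(X^H_tX^H_s\right)\le C|t-s|^{2H-2}$; if $H=\frac12$, then $E\left(X^H_tX^H_s\right)\le Ce^{-\theta|t-s|}$. -/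

import Mathlib

open MeasureTheory ProbabilityTheory Filter Topology
open scoped Nat

/-- `I` is the Riemann-Stieltjes integral of `f` with respect to `g` over `[a, b]` (`a ≤ b`): the
sums `∑ f (ξ i) * (g (x (i + 1)) - g (x i))` over the tagged partitions
`a = x 0 ≤ ξ 0 ≤ x 1 ≤ ⋯ ≤ x n = b` tend to `I` as the mesh tends to zero. -/
def HasRSIntegral (f g : ℝ → ℝ) (a b I : ℝ) : Prop :=
  a ≤ b ∧ ∀ ε > 0, ∃ δ > 0, ∀ (n : ℕ) (x ξ : ℕ → ℝ), x 0 = a → x n = b →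
    (∀ i < n, x i ≤ ξ i ∧ ξ i ≤ x (i + 1) ∧ x (i + 1) - x i < δ) →
    |∑ i ∈ Finset.range n, f (ξ i) * (g (x (i + 1)) - g (x i)) - I| < ε

open Classical in
/-- The Riemann-Stieltjes integral of `f` with respect to `g` over `[a, b]`
(zero when it does not exist). -/
noncomputable def rsIntegral (f g : ℝ → ℝ) (a b : ℝ) : ℝ :=
  if h : ∃ I, HasRSIntegral f g a b I then h.choose else 0

/-- `I` is the improper Riemann-Stieltjes integral of `f` with respect to `g` over `(-∞, b]`:
the integral over every `[a, b]` exists, and it tends to `I` as `a → -∞`. -/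
def HasRSIntegralIic (f g : ℝ → ℝ) (b I : ℝ) : Prop :=
  (∀ a ≤ b, ∃ J, HasRSIntegral f g a b J) ∧ Tendsto (fun a ↦ rsIntegral f g a b) atBot (𝓝 I)

open Classical in
/-- The improper Riemann-Stieltjes integral of `f` with respect to `g` over `(-∞, b]`
(zero when it does not exist). -/
noncomputable def rsIntegralIic (f g : ℝ → ℝ) (b : ℝ) : ℝ :=
  if h : ∃ I, HasRSIntegralIic f g b I then h.choose else 0

/-- `B`, indexed by `ℝ`, is a fractional Brownian motion with Hurst parameter `H`: a centered
Gaussian process with the covariance of fractional Brownian motion and almost surely continuous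
paths. -/
structure IsFractionalBrownianMotion {Ω : Type*} [MeasurableSpace Ω] (H : ℝ) (B : ℝ → Ω → ℝ)
    (P : Measure Ω) : Prop where
  isGaussianProcess : IsGaussianProcess B P
  centered : ∀ t, ∫ ω, B t ω ∂P = 0
  covariance : ∀ t s, ∫ ω, B t ω * B s ω ∂P =
    1 / 2 * (|t| ^ (2 * H) + |s| ^ (2 * H) - |t - s| ^ (2 * H))
  continuous_paths : ∀ᵐ ω ∂P, Continuous fun t ↦ B t ω

/-- The fractional Ornstein-Uhlenbeck process `X t = e^{-θ t} ∫_0^t e^{θ s} dB_s`, `t ≥ 0`, started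
at zero; the integral is a pathwise Riemann-Stieltjes integral. -/
noncomputable def fouX {Ω : Type*} (θ : ℝ) (B : ℝ → Ω → ℝ) (t : ℝ) (ω : Ω) : ℝ :=
  Real.exp (-θ * t) * rsIntegral (fun s ↦ Real.exp (θ * s)) (fun s ↦ B s ω) 0 t

/-- The fractional Ornstein-Uhlenbeck process `Z t = ∫_{-∞}^t e^{-θ (t - s)} dB_s`; the integral is
a pathwise improper Riemann-Stieltjes integral. -/
noncomputable def fouZ {Ω : Type*} (θ : ℝ) (B : ℝ → Ω → ℝ) (t : ℝ) (ω : Ω) : ℝ :=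
  rsIntegralIic (fun s ↦ Real.exp (-θ * (t - s))) (fun s ↦ B s ω) t

/-- A real process indexed by `ℝ` is (strictly) stationary: for every shift `h`, the processes
`(Y (t + h))_t` and `(Y t)_t` have the same finite-dimensional distributions. -/
def IsStationaryProcess {Ω : Type*} [MeasurableSpace Ω] (Y : ℝ → Ω → ℝ) (P : Measure Ω) : Prop :=
  ∀ (h : ℝ) (I : Finset ℝ),
    IdentDistrib (fun ω (i : I) ↦ Y (i + h) ω) (fun ω (i : I) ↦ Y i ω) P P

/-- Ergodicity of a (stationary) process indexed by `ℝ`: every event `{Y ∈ A}`, with `A` a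
measurable set of paths, which is invariant up to null sets under all time shifts has probability
zero or one. (Exact invariance under all real shifts would be void here: a set of the product
σ-algebra depends on countably many coordinates only, so that the exactly invariant ones are
trivial.) -/
def IsErgodicProcess {Ω : Type*} [MeasurableSpace Ω] (Y : ℝ → Ω → ℝ) (P : Measure Ω) : Prop :=
  ∀ A : Set (ℝ → ℝ), MeasurableSet A →
    (∀ h : ℝ, ∀ᵐ ω ∂P, (fun t ↦ Y (t + h) ω) ∈ A ↔ (fun t ↦ Y t ω) ∈ A) →
    (∀ᵐ ω ∂P, (fun t ↦ Y t ω) ∈ A) ∨ (∀ᵐ ω ∂P, (fun t ↦ Y t ω) ∉ A)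

/-! The exponential integrand is continuously differentiable, so integration by parts
(`hasRSIntegral_of_hasDerivAt`) gives the pathwise integral against any continuous path. Almost
surely `B` grows at most polynomially at `-∞` (`ae_exists_dyadic_bound`, a Kolmogorov-type
argument). The improper integral then converges, to `Z t = θ ∫_0^∞ e^{-θu} (B t - B (t - u)) du`,
and splitting it at time `0` gives `X t = Z t - e^{-θt} Z 0`. Hence everything reduces to `Z`.

As an almost sure limit of Riemann sums, `Z` is a centered Gaussian process (`of_ae_tendsto`).
Fubini's theorem, applied twice, turns its covariance into an average of increment covariances over
two independent exponential lags. The difference of the lags has a Laplace law, which leaves a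
single integral, `fouCov`: the exponential average of the second difference of `|·|^{2H}` at `t`. At
`t = 0` this is a Gamma integral; for `H = 1/2` it is explicit. For large `t` the second difference
behaves like `2H(2H-1) t^{2H-2} w²`, and a global quadratic bound supplies both the domination and a
power bound for all `t > 0`.

The covariance depends on `t - s` only, so `Z` is stationary; it tends to zero, so distant copies of
finitely many coordinates become independent, `Z` is mixing, and invariant events are trivial
(`isErgodicProcess`). Gaussian moments are functions of the variance, and the variance of `X t`
differs from that of `Z 0` by `O(e^{-θt})`. Finally the covariance of `X` is a combination of four
values of `fouCov`, each bounded directly. -/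

/-! ### Pathwise Riemann-Stieltjes integrals: uniqueness and integration by parts. -/

theorem exists_partition_of_mesh {a b δ : ℝ} (hab : a ≤ b) (hδ : 0 < δ) :
    ∃ (n : ℕ) (x : ℕ → ℝ), x 0 = a ∧ x n = b ∧ ∀ i < n, x i ≤ x (i + 1) ∧ x (i + 1) - x i < δ := by
  obtain ⟨n, hn⟩ := exists_nat_gt ((b - a) / δ)
  have hn' : (0 : ℝ) < n := lt_of_le_of_lt (div_nonneg (by linarith) hδ.le) hn
  refine ⟨n, fun i ↦ a + i * ((b - a) / n), by simp, by field_simp; ring, fun i _ ↦ ?_⟩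
  have h0 : 0 ≤ (b - a) / n := div_nonneg (by linarith) hn'.le
  have h1 : (b - a) / n < δ := by
    rw [div_lt_iff₀ hδ] at hn
    rw [div_lt_iff₀ hn']
    linarith
  push_cast
  constructor <;> nlinarith

theorem HasRSIntegral.unique {f g : ℝ → ℝ} {a b I J : ℝ} (hI : HasRSIntegral f g a b I)
    (hJ : HasRSIntegral f g a b J) : I = J := by
  by_contra hne
  have hε : 0 < |I - J| / 2 := by
    have := abs_pos.2 (sub_ne_zero.2 hne)
    linarith
  obtain ⟨δ₁, h₁, H₁⟩ := hI.2 _ hε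
  obtain ⟨δ₂, h₂, H₂⟩ := hJ.2 _ hε
  obtain ⟨n, x, hx0, hxn, hx⟩ := exists_partition_of_mesh hI.1 (lt_min h₁ h₂)
  have k₁ := H₁ n x x hx0 hxn fun i hi ↦
    ⟨le_rfl, (hx i hi).1, (hx i hi).2.trans_le (min_le_left _ _)⟩
  have k₂ := H₂ n x x hx0 hxn fun i hi ↦
    ⟨le_rfl, (hx i hi).1, (hx i hi).2.trans_le (min_le_right _ _)⟩
  rw [abs_sub_comm] at k₁
  have := abs_sub_le I (∑ i ∈ Finset.range n, f (x i) * (g (x (i + 1)) - g (x i))) J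
  linarith

theorem HasRSIntegral.rsIntegral_eq {f g : ℝ → ℝ} {a b I : ℝ} (h : HasRSIntegral f g a b I) :
    rsIntegral f g a b = I := by
  have hex : ∃ I, HasRSIntegral f g a b I := ⟨I, h⟩
  rw [rsIntegral, dif_pos hex]
  exact hex.choose_spec.unique h

theorem HasRSIntegralIic.rsIntegralIic_eq {f g : ℝ → ℝ} {b I : ℝ} (h : HasRSIntegralIic f g b I) :
    rsIntegralIic f g b = I := by
  have hex : ∃ I, HasRSIntegralIic f g b I := ⟨I, h⟩
  rw [rsIntegralIic, dif_pos hex]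
  exact tendsto_nhds_unique hex.choose_spec.2 h.2

/-- Summation by parts over one cell of a tagged partition. -/
theorem abs_cell_sub_le {f f' g : ℝ → ℝ} (hf : ∀ x, HasDerivAt f (f' x) x) (hf' : Continuous f')
    (hg : Continuous g) {x ξ y M η : ℝ} (hxξ : x ≤ ξ) (hξy : ξ ≤ y)
    (hM : ∀ s ∈ Set.Icc x y, |f' s| ≤ M)
    (hη : ∀ s ∈ Set.Icc x y, |g y - g s| ≤ η ∧ |g x - g s| ≤ η) :
    |f ξ * (g y - g x) - (f y * g y - f x * g x - ∫ s in x..y, f' s * g s)|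
      ≤ M * η * (y - x) := by
  have hI (p q : ℝ) : IntervalIntegrable f' volume p q := hf'.intervalIntegrable _ _
  have hIg (p q : ℝ) : IntervalIntegrable (fun s ↦ f' s * g s) volume p q :=
    (hf'.mul hg).intervalIntegrable _ _
  have e₁ : f y - f ξ = ∫ s in ξ..y, f' s :=
    (intervalIntegral.integral_eq_sub_of_hasDerivAt (fun s _ ↦ hf s) (hI _ _)).symm
  have e₂ : f ξ - f x = ∫ s in x..ξ, f' s :=
    (intervalIntegral.integral_eq_sub_of_hasDerivAt (fun s _ ↦ hf s) (hI _ _)).symm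
  have k₁ : ∫ s in ξ..y, f' s * (g y - g s) = (f y - f ξ) * g y - ∫ s in ξ..y, f' s * g s := by
    simp_rw [mul_sub]
    rw [intervalIntegral.integral_sub ((hI _ _).mul_const _) (hIg _ _),
      intervalIntegral.integral_mul_const, e₁]
  have k₂ : ∫ s in x..ξ, f' s * (g x - g s) = (f ξ - f x) * g x - ∫ s in x..ξ, f' s * g s := by
    simp_rw [mul_sub]
    rw [intervalIntegral.integral_sub ((hI _ _).mul_const _) (hIg _ _),
      intervalIntegral.integral_mul_const, e₂]
  -- The boundary terms cancel, and what remains is `f'` times the oscillation of `g`: measured from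
  -- `g y` to the right of the tag and from `g x` to its left.
  have key : f ξ * (g y - g x) - (f y * g y - f x * g x - ∫ s in x..y, f' s * g s)
      = -(∫ s in ξ..y, f' s * (g y - g s)) - ∫ s in x..ξ, f' s * (g x - g s) := by
    rw [k₁, k₂, ← intervalIntegral.integral_add_adjacent_intervals (hIg x ξ) (hIg ξ y)]
    ring
  have b₁ : |∫ s in ξ..y, f' s * (g y - g s)| ≤ M * η * |y - ξ| := by
    rw [← Real.norm_eq_abs]
    refine intervalIntegral.norm_integral_le_of_norm_le_const fun s hs ↦ ?_
    rw [Set.uIoc_of_le hξy] at hs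
    have hs' : s ∈ Set.Icc x y := ⟨hxξ.trans hs.1.le, hs.2⟩
    rw [Real.norm_eq_abs, abs_mul]
    exact mul_le_mul (hM s hs') (hη s hs').1 (abs_nonneg _) ((abs_nonneg _).trans (hM s hs'))
  have b₂ : |∫ s in x..ξ, f' s * (g x - g s)| ≤ M * η * |ξ - x| := by
    rw [← Real.norm_eq_abs]
    refine intervalIntegral.norm_integral_le_of_norm_le_const fun s hs ↦ ?_
    rw [Set.uIoc_of_le hxξ] at hs
    have hs' : s ∈ Set.Icc x y := ⟨hs.1.le, hs.2.trans hξy⟩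
    rw [Real.norm_eq_abs, abs_mul]
    exact mul_le_mul (hM s hs') (hη s hs').2 (abs_nonneg _) ((abs_nonneg _).trans (hM s hs'))
  rw [abs_of_nonneg (sub_nonneg.2 hξy)] at b₁
  rw [abs_of_nonneg (sub_nonneg.2 hxξ)] at b₂
  rw [key]
  refine (abs_sub _ _).trans ?_
  rw [abs_neg]
  linarith [mul_sub (M * η) y ξ, mul_sub (M * η) ξ x, mul_sub (M * η) y x]

/-- Integration by parts: a continuously differentiable integrand is Riemann-Stieltjes integrable
against every continuous integrator. -/
theorem hasRSIntegral_of_hasDerivAt {f f' g : ℝ → ℝ} (hf : ∀ x, HasDerivAt f (f' x) x)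
    (hf' : Continuous f') (hg : Continuous g) {a b : ℝ} (hab : a ≤ b) :
    HasRSIntegral f g a b (f b * g b - f a * g a - ∫ s in a..b, f' s * g s) := by
  refine ⟨hab, fun ε hε ↦ ?_⟩
  obtain ⟨M, hM⟩ := isCompact_Icc.exists_bound_of_continuousOn (s := Set.Icc a b) hf'.continuousOn
  have hM0 : 0 ≤ M := (norm_nonneg _).trans (hM a ⟨le_rfl, hab⟩)
  have huc := isCompact_Icc.uniformContinuousOn_of_continuous (s := Set.Icc a b) hg.continuousOn
  obtain ⟨η, hη0, hη⟩ : ∃ η > 0, M * η * (b - a) < ε := by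
    refine ⟨ε / (M * (b - a) + 1), by have := sub_nonneg.2 hab; positivity, ?_⟩
    have h0 : 0 ≤ M * (b - a) := mul_nonneg hM0 (sub_nonneg.2 hab)
    rw [mul_div_assoc', div_mul_eq_mul_div, div_lt_iff₀ (by linarith)]
    nlinarith
  obtain ⟨δ, hδ, H⟩ := Metric.uniformContinuousOn_iff.1 huc η hη0
  refine ⟨δ, hδ, fun n x ξ hx0 hxn h ↦ ?_⟩
  have hstep : ∀ i < n, x i ≤ x (i + 1) := fun i hi ↦ (h i hi).1.trans (h i hi).2.1
  have hmono : ∀ i j, i ≤ j → j ≤ n → x i ≤ x j := by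
    intro i j hij
    induction j, hij using Nat.le_induction with
    | base => intro _; exact le_rfl
    | succ k _ ih => intro hk; exact (ih (by omega)).trans (hstep k (by omega))
  have hsub : ∀ i < n, Set.Icc (x i) (x (i + 1)) ⊆ Set.Icc a b := fun i hi ↦
    Set.Icc_subset_Icc (hx0 ▸ hmono 0 i (by omega) (by omega))
      (hxn ▸ hmono (i + 1) n (by omega) le_rfl)
  have hIg (p q : ℝ) : IntervalIntegrable (fun s ↦ f' s * g s) volume p q :=
    (hf'.mul hg).intervalIntegrable _ _
  have htel : f b * g b - f a * g a - ∫ s in a..b, f' s * g s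
      = ∑ i ∈ Finset.range n, (f (x (i + 1)) * g (x (i + 1)) - f (x i) * g (x i)
          - ∫ s in x i..x (i + 1), f' s * g s) := by
    rw [Finset.sum_sub_distrib, Finset.sum_range_sub (fun i ↦ f (x i) * g (x i)), hx0, hxn,
      intervalIntegral.sum_integral_adjacent_intervals fun _ _ ↦ hIg _ _, hx0, hxn]
  rw [htel, ← Finset.sum_sub_distrib]
  calc |∑ i ∈ Finset.range n, (f (ξ i) * (g (x (i + 1)) - g (x i))
          - (f (x (i + 1)) * g (x (i + 1)) - f (x i) * g (x i)
          - ∫ s in x i..x (i + 1), f' s * g s))|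
      ≤ ∑ i ∈ Finset.range n, M * η * (x (i + 1) - x i) := by
        refine (Finset.abs_sum_le_sum_abs _ _).trans (Finset.sum_le_sum fun i hi ↦ ?_)
        have hi' := Finset.mem_range.1 hi
        obtain ⟨h₁, h₂, h₃⟩ := h i hi'
        have hle := hstep i hi'
        refine abs_cell_sub_le hf hf' hg h₁ h₂ (fun s hs ↦ hM s (hsub i hi' hs)) fun s hs ↦ ⟨?_, ?_⟩
        · refine (H _ (hsub i hi' ⟨hle, le_rfl⟩) _ (hsub i hi' hs) ?_).le
          rw [Real.dist_eq, abs_lt]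
          constructor <;> linarith [hs.1, hs.2]
        · refine (H _ (hsub i hi' ⟨le_rfl, hle⟩) _ (hsub i hi' hs) ?_).le
          rw [Real.dist_eq, abs_lt]
          constructor <;> linarith [hs.1, hs.2]
    _ = M * η * (b - a) := by rw [← Finset.mul_sum, Finset.sum_range_sub, hx0, hxn]
    _ < ε := hη

theorem hasDerivAt_exp_mul (θ x : ℝ) :
    HasDerivAt (fun s ↦ Real.exp (θ * s)) (θ * Real.exp (θ * x)) x := by
  simpa [mul_comm] using ((hasDerivAt_id x).const_mul θ).exp

theorem hasDerivAt_exp_neg_mul_sub (θ t x : ℝ) :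
    HasDerivAt (fun s ↦ Real.exp (-θ * (t - s))) (θ * Real.exp (-θ * (t - x))) x := by
  simpa [mul_comm] using (((hasDerivAt_id x).const_sub t).const_mul (-θ)).exp

theorem hasRSIntegral_exp {g : ℝ → ℝ} (hg : Continuous g) (θ : ℝ) {t : ℝ} (ht : 0 ≤ t) :
    HasRSIntegral (fun s ↦ Real.exp (θ * s)) g 0 t
      (Real.exp (θ * t) * g t - g 0 - ∫ s in (0 : ℝ)..t, θ * Real.exp (θ * s) * g s) := by
  simpa using hasRSIntegral_of_hasDerivAt (hasDerivAt_exp_mul θ) (by fun_prop) hg ht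

theorem hasRSIntegral_exp_sub {g : ℝ → ℝ} (hg : Continuous g) (θ t : ℝ) {a : ℝ} (ha : a ≤ t) :
    HasRSIntegral (fun s ↦ Real.exp (-θ * (t - s))) g a t
      (g t - Real.exp (-θ * (t - a)) * g a - ∫ s in a..t, θ * Real.exp (-θ * (t - s)) * g s) := by
  simpa using hasRSIntegral_of_hasDerivAt (hasDerivAt_exp_neg_mul_sub θ t) (by fun_prop) hg ha

/-! ### The improper integral at `-∞` for integrators of controlled growth. -/

section Growth

variable {g : ℝ → ℝ} {θ : ℝ}

/-- Half of the decay rate `θ` pays for the growth of `g`; the other half remains for integrability.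
-/
theorem isBigO_exp_neg_mul_comp_sub (hgr : g =O[atBot] fun s ↦ Real.exp (-(θ / 2) * s)) (t : ℝ) :
    (fun u ↦ Real.exp (-θ * u) * g (t - u)) =O[atTop] fun u ↦ Real.exp (-(θ / 2) * u) := by
  have h₁ : Tendsto (fun u : ℝ ↦ t - u) atTop atBot := 
    tendsto_atBot_add_const_left _ t tendsto_neg_atTop_atBot
  have h₂ := (Asymptotics.isBigO_refl (fun u : ℝ ↦ Real.exp (-θ * u)) atTop).mul
    (hgr.comp_tendsto h₁)
  refine h₂.trans (Asymptotics.IsBigO.of_bound (Real.exp (-(θ / 2) * t)) (Eventually.of_forall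
    fun u ↦ le_of_eq ?_))
  simp only [Function.comp, Real.norm_eq_abs, Real.abs_exp, ← Real.exp_add]
  ring_nf

theorem integrableOn_exp_neg_mul_comp_sub (hθ : 0 < θ) (hg : Continuous g)
    (hgr : g =O[atBot] fun s ↦ Real.exp (-(θ / 2) * s)) (t : ℝ) :
    IntegrableOn (fun u ↦ Real.exp (-θ * u) * g (t - u)) (Set.Ioi 0) :=
  integrable_of_isBigO_exp_neg (half_pos hθ) (by fun_prop) (isBigO_exp_neg_mul_comp_sub hgr t)

theorem integrableOn_exp_neg_mul_Ioi (hθ : 0 < θ) :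
    IntegrableOn (fun u : ℝ ↦ Real.exp (-θ * u)) (Set.Ioi 0) :=
  exp_neg_integrableOn_Ioi 0 hθ

theorem integral_exp_neg_mul_Ioi_zero (hθ : 0 < θ) :
    ∫ u in Set.Ioi (0 : ℝ), Real.exp (-θ * u) = θ⁻¹ := by
  rw [integral_exp_mul_Ioi (by linarith)]
  simp

/-- The pathwise improper integral defining the stationary process, in terms of increments. -/
theorem hasRSIntegralIic_exp_sub (hθ : 0 < θ) (hg : Continuous g)
    (hgr : g =O[atBot] fun s ↦ Real.exp (-(θ / 2) * s)) (t : ℝ) :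
    HasRSIntegralIic (fun s ↦ Real.exp (-θ * (t - s))) g t
      (θ * ∫ u in Set.Ioi (0 : ℝ), Real.exp (-θ * u) * (g t - g (t - u))) := by
  refine ⟨fun a ha ↦ ⟨_, hasRSIntegral_exp_sub hg θ t ha⟩, ?_⟩
  have hint := integrableOn_exp_neg_mul_comp_sub hθ hg hgr t
  -- Since `θ e^{-θu}` has total mass one, the boundary term `g t` can be put under the integral.
  have hval : θ * ∫ u in Set.Ioi (0 : ℝ), Real.exp (-θ * u) * (g t - g (t - u))
      = g t - 0 - θ * ∫ u in Set.Ioi (0 : ℝ), Real.exp (-θ * u) * g (t - u) := by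
    simp_rw [mul_sub]
    rw [integral_sub ((integrableOn_exp_neg_mul_Ioi hθ).mul_const _) hint, integral_mul_const,
      integral_exp_neg_mul_Ioi_zero hθ]
    field_simp
    ring
  have hsub : Tendsto (fun a : ℝ ↦ t - a) atBot atTop :=
    tendsto_atTop_add_const_left _ t tendsto_neg_atBot_atTop
  have h₁ : Tendsto (fun a ↦ Real.exp (-θ * (t - a)) * g a) atBot (𝓝 0) := by
    have h := (isBigO_exp_neg_mul_comp_sub hgr t).trans_tendsto
      (Real.tendsto_exp_atBot.comp (tendsto_id.const_mul_atTop_of_neg (by linarith : -(θ / 2) < 0)))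
    simpa [Function.comp_def] using h.comp hsub
  have h₂ : Tendsto (fun a ↦ ∫ s in a..t, θ * Real.exp (-θ * (t - s)) * g s) atBot
      (𝓝 (θ * ∫ u in Set.Ioi (0 : ℝ), Real.exp (-θ * u) * g (t - u))) := by
    have h := (intervalIntegral_tendsto_integral_Ioi 0 hint hsub).const_mul θ
    refine h.congr fun a ↦ ?_
    have := intervalIntegral.integral_comp_sub_left
      (fun s ↦ θ * Real.exp (-θ * (t - s)) * g s) t (a := 0) (b := t - a)
    simp only [sub_sub_cancel, sub_zero, mul_assoc] at this
    rw [← intervalIntegral.integral_const_mul, this]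
    simp only [mul_assoc]
  rw [hval]
  refine ((tendsto_const_nhds.sub h₁).sub h₂).congr' ?_
  filter_upwards [eventually_le_atBot t] with a ha
  exact (hasRSIntegral_exp_sub hg θ t ha).rsIntegral_eq.symm

/-- The process started at zero in terms of the stationary one. -/
theorem exp_mul_rsIntegral_eq (hθ : 0 < θ) (hg : Continuous g)
    (hgr : g =O[atBot] fun s ↦ Real.exp (-(θ / 2) * s)) {t : ℝ} (ht : 0 ≤ t) :
    Real.exp (-θ * t) * rsIntegral (fun s ↦ Real.exp (θ * s)) g 0 t
      = rsIntegralIic (fun s ↦ Real.exp (-θ * (t - s))) g t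
        - Real.exp (-θ * t) * rsIntegralIic (fun s ↦ Real.exp (-θ * (0 - s))) g 0 := by
  have hZ (t : ℝ) := hasRSIntegralIic_exp_sub hθ hg hgr t
  have hX := (hZ t).2
  have h0 := ((hZ 0).2).const_mul (Real.exp (-θ * t))
  rw [(hZ t).rsIntegralIic_eq, (hZ 0).rsIntegralIic_eq]
  -- For each lower limit `a ≤ 0` the identity is exact, by splitting the integral at `0`; the left
  -- side does not depend on `a`.
  refine tendsto_nhds_unique (tendsto_const_nhds (f := atBot)) ((hX.sub h0).congr' ?_)
  filter_upwards [eventually_le_atBot 0] with a ha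
  rw [(hasRSIntegral_exp_sub hg θ t (ha.trans ht)).rsIntegral_eq,
    (hasRSIntegral_exp_sub hg θ 0 ha).rsIntegral_eq, (hasRSIntegral_exp hg θ ht).rsIntegral_eq]
  have e (s r : ℝ) : Real.exp (-θ * (s - r)) = Real.exp (-θ * s) * Real.exp (θ * r) := by
    rw [← Real.exp_add]; ring_nf
  have hc (p q : ℝ) : IntervalIntegrable (fun s ↦ θ * Real.exp (θ * s) * g s) volume p q :=
    Continuous.intervalIntegrable (by fun_prop) _ _
  have hi (r p q : ℝ) : ∫ s in p..q, θ * Real.exp (-θ * (r - s)) * g s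
      = Real.exp (-θ * r) * ∫ s in p..q, θ * Real.exp (θ * s) * g s := by
    rw [← intervalIntegral.integral_const_mul]
    congr 1 with s
    rw [e]; ring
  rw [hi, hi, e, e, ← intervalIntegral.integral_add_adjacent_intervals (hc a 0) (hc 0 t)]
  have h1 : Real.exp (-θ * t) * Real.exp (θ * t) = 1 := by rw [← Real.exp_add]; simp
  simp only [mul_zero, Real.exp_zero]
  linear_combination g t * (-h1)

end Growth

/-! ### Moments of centered Gaussian variables. -/

/-- The function `f` is the moment generating function of variance `v` and satisfies `f' = v t f`;
this is the Leibniz rule for that equation. At `t = 0` it becomes the moment recursion `m (n+2) = v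
(n+1) m n`. -/
theorem iteratedDeriv_exp_mul_sq_div_two (v : ℝ) (n : ℕ) (t : ℝ) :
    iteratedDeriv (n + 2) (fun t ↦ Real.exp (v * t ^ 2 / 2)) t
      = v * (t * iteratedDeriv (n + 1) (fun t ↦ Real.exp (v * t ^ 2 / 2)) t
        + (n + 1) * iteratedDeriv n (fun t ↦ Real.exp (v * t ^ 2 / 2)) t) := by
  set f : ℝ → ℝ := fun t ↦ Real.exp (v * t ^ 2 / 2) with hf
  have hcd : ContDiff ℝ ⊤ f := by fun_prop
  have hd (k : ℕ) (t : ℝ) : HasDerivAt (iteratedDeriv k f) (iteratedDeriv (k + 1) f t) t := by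
    rw [iteratedDeriv_succ]
    exact ((hcd.differentiable_iteratedDeriv k (by exact_mod_cast WithTop.coe_lt_top _)) t).hasDerivAt
  have h1 (t : ℝ) : iteratedDeriv 1 f t = v * (t * iteratedDeriv 0 f t) := by
    rw [iteratedDeriv_one, iteratedDeriv_zero]
    have : HasDerivAt f (Real.exp (v * t ^ 2 / 2) * (v * (2 * t) / 2)) t := by
      simpa using ((((hasDerivAt_id t).pow 2).const_mul v).div_const 2).exp
    rw [this.deriv, hf]
    ring
  induction n generalizing t with
  | zero =>
    have e : iteratedDeriv 1 f = fun t ↦ v * (t * iteratedDeriv 0 f t) := funext h1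
    have h := (((hasDerivAt_id t).mul (hd 0 t)).const_mul v)
    rw [iteratedDeriv_succ, show deriv (iteratedDeriv (1) f) t = _ from
      (congrArg (deriv · t) e).trans h.deriv]
    simp only [id, zero_add]
    push_cast
    ring
  | succ n ih =>
    have e : iteratedDeriv (n + 2) f = fun t ↦ v * (t * iteratedDeriv (n + 1) f t
        + (n + 1) * iteratedDeriv n f t) := funext ih
    have h := ((((hasDerivAt_id t).mul (hd (n + 1) t)).add
      ((hd n t).const_mul ((n : ℝ) + 1))).const_mul v)
    rw [show n + 1 + 2 = (n + 2) + 1 from rfl, iteratedDeriv_succ, show deriv (iteratedDeriv (n + 2) f) t = _ from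
      (congrArg (deriv · t) e).trans h.deriv]
    simp only [id]
    push_cast
    ring

theorem integral_pow_gaussianReal_eq_iteratedDeriv (v : NNReal) (n : ℕ) :
    ∫ x, x ^ n ∂(gaussianReal 0 v) = iteratedDeriv n (fun t ↦ Real.exp (v * t ^ 2 / 2)) 0 := by
  have h := iteratedDeriv_mgf_zero (X := id) (μ := gaussianReal 0 v) (by simp) n
  simp only [mgf_id_gaussianReal, zero_mul, zero_add] at h
  rw [h]
  simp

theorem integral_pow_gaussianReal_add_two (v : NNReal) (n : ℕ) :
    ∫ x, x ^ (n + 2) ∂(gaussianReal 0 v) = v * (n + 1) * ∫ x, x ^ n ∂(gaussianReal 0 v) := by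
  simp only [integral_pow_gaussianReal_eq_iteratedDeriv, iteratedDeriv_exp_mul_sq_div_two]
  ring

theorem integral_pow_two_mul_gaussianReal (v : NNReal) (k : ℕ) :
    ∫ x, x ^ (2 * k) ∂(gaussianReal 0 v) = ((2 * k)! : ℝ) / (2 ^ k * (k ! : ℝ)) * (v : ℝ) ^ k := by
  induction k with
  | zero => simp
  | succ k ih =>
    rw [show 2 * (k + 1) = 2 * k + 2 by ring, integral_pow_gaussianReal_add_two, ih,
      Nat.factorial_succ, Nat.factorial_succ, Nat.factorial_succ]
    have : (k ! : ℝ) ≠ 0 := by positivity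
    push_cast
    field_simp
    ring

theorem integral_pow_two_mul_add_one_gaussianReal (v : NNReal) (k : ℕ) :
    ∫ x, x ^ (2 * k + 1) ∂(gaussianReal 0 v) = 0 := by
  induction k with
  | zero => simp
  | succ k ih =>
    rw [show 2 * (k + 1) + 1 = 2 * k + 1 + 2 by ring, integral_pow_gaussianReal_add_two, ih,
      mul_zero]

section Centered

variable {Ω : Type*} [MeasurableSpace Ω] {P : Measure Ω} {Y : Ω → ℝ}

theorem map_eq_gaussianReal_of_centered (hY : HasGaussianLaw Y P) (h0 : ∫ ω, Y ω ∂P = 0) :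
    P.map Y = gaussianReal 0 (∫ ω, Y ω ^ 2 ∂P).toNNReal := by
  rw [hY.map_eq_gaussianReal, h0, variance_of_integral_eq_zero hY.aemeasurable h0]

theorem integral_pow_two_mul_of_hasGaussianLaw (hY : HasGaussianLaw Y P) (h0 : ∫ ω, Y ω ∂P = 0)
    (k : ℕ) :
    ∫ ω, Y ω ^ (2 * k) ∂P = ((2 * k)! : ℝ) / (2 ^ k * (k ! : ℝ)) * (∫ ω, Y ω ^ 2 ∂P) ^ k := by
  rw [← integral_map (f := fun x : ℝ ↦ x ^ (2 * k)) hY.aemeasurable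
    (Continuous.aestronglyMeasurable (by fun_prop)), map_eq_gaussianReal_of_centered hY h0,
    integral_pow_two_mul_gaussianReal,
    Real.coe_toNNReal _ (integral_nonneg fun ω ↦ sq_nonneg (Y ω))]

theorem integral_pow_two_mul_add_one_of_hasGaussianLaw (hY : HasGaussianLaw Y P)
    (h0 : ∫ ω, Y ω ∂P = 0) (k : ℕ) : ∫ ω, Y ω ^ (2 * k + 1) ∂P = 0 := by
  rw [← integral_map (f := fun x : ℝ ↦ x ^ (2 * k + 1)) hY.aemeasurable
    (Continuous.aestronglyMeasurable (by fun_prop)), map_eq_gaussianReal_of_centered hY h0,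
    integral_pow_two_mul_add_one_gaussianReal]

end Centered

/-! ### Growth of a continuous function from its dyadic increments. -/

/-- Chaining: the dyadic floors of `t` start at `⌊t⌋₊` and converge to `t`, and consecutive ones are
equal or neighbours on the finer grid, so a geometric series bounds the total increment. -/
theorem abs_sub_floor_le_of_dyadic {g : ℝ → ℝ} (hg : Continuous g) {t A ρ : ℝ} (ht : 0 ≤ t)
    (hA : 0 ≤ A) (hρ0 : 0 ≤ ρ) (hρ : ρ < 1)
    (h : ∀ m k : ℕ, (k : ℝ) ≤ 2 ^ m * t →
      |g ((k + 1) / 2 ^ m) - g (k / 2 ^ m)| ≤ A * ρ ^ m) :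
    |g t - g ⌊t⌋₊| ≤ A / (1 - ρ) := by
  set x : ℕ → ℝ := fun m ↦ (⌊2 ^ m * t⌋₊ : ℝ) / 2 ^ m with hx
  have hlim : Tendsto x atTop (𝓝 t) := by
    have := (tendsto_nat_floor_mul_div_atTop ht).comp
      (tendsto_pow_atTop_atTop_of_one_lt (one_lt_two (α := ℝ)))
    refine this.congr fun m ↦ ?_
    simp only [Function.comp, hx, mul_comm]
  have hstep (m : ℕ) : dist (g (x m)) (g (x (m + 1))) ≤ A * ρ ^ m := by
    have hle : A * ρ ^ (m + 1) ≤ A * ρ ^ m :=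
      mul_le_mul_of_nonneg_left (pow_le_pow_of_le_one hρ0 hρ.le (Nat.le_succ m)) hA
    set k := ⌊2 ^ m * t⌋₊ with hk
    have h0 : 0 ≤ 2 ^ m * t := by positivity
    have hk₁ : (k : ℝ) ≤ 2 ^ m * t := Nat.floor_le h0
    have hk₂ : 2 ^ m * t < k + 1 := Nat.lt_floor_add_one _
    have hxm : x m = ((2 * k : ℕ) : ℝ) / 2 ^ (m + 1) := by
      simp only [hx, ← hk]
      push_cast
      field_simp
      ring
    have h2k : ((2 * k : ℕ) : ℝ) ≤ 2 ^ (m + 1) * t := by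
      push_cast
      rw [pow_succ]
      linarith
    -- Passing to the finer level, the floor is either `2k` (no move) or `2k + 1` (one increment).
    by_cases hc : ((2 * k + 1 : ℕ) : ℝ) ≤ 2 ^ (m + 1) * t
    · have hf : ⌊2 ^ (m + 1) * t⌋₊ = 2 * k + 1 := by
        rw [Nat.floor_eq_iff (by positivity)]
        refine ⟨hc, ?_⟩
        push_cast
        rw [pow_succ]
        linarith
      have hxs : x (m + 1) = (((2 * k : ℕ) : ℝ) + 1) / 2 ^ (m + 1) := by
        simp only [hx, hf]
        push_cast
        ring
      rw [dist_comm, Real.dist_eq, hxs, hxm]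
      exact (h (m + 1) (2 * k) h2k).trans hle
    · have hf : ⌊2 ^ (m + 1) * t⌋₊ = 2 * k := by
        rw [Nat.floor_eq_iff (by positivity)]
        refine ⟨h2k, ?_⟩
        push_cast at hc ⊢
        exact not_le.1 hc
      have hxs : x (m + 1) = x m := by rw [hxm]; simp only [hx, hf]
      rw [hxs, dist_self]
      positivity
  have := dist_le_of_le_geometric_of_tendsto₀ ρ A hρ hstep ((hg.tendsto t).comp hlim)
  rw [dist_comm, Real.dist_eq] at this
  simpa [hx] using this

/-- Summable dyadic increments of a continuous function force polynomial growth. -/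
theorem exists_forall_abs_le_of_dyadic {g : ℝ → ℝ} (hg : Continuous g) {p : ℕ} (hp : p ≠ 0) {S : ℝ}
    (h : ∀ m k : ℕ, |g ((k + 1) / 2 ^ m) - g (k / 2 ^ m)| ^ p ≤ S * ((k + 1) ^ 2 / 8 ^ m)) :
    ∃ C, ∀ t ≥ 0, |g t| ≤ C * (t + 2) ^ 3 := by
  have hS : 0 ≤ S := by
    have := (pow_nonneg (abs_nonneg _) p).trans (h 0 0)
    simpa using this
  -- For `k ≤ 2^m t` the factor `(k+1)²` costs `4^m`, so `8^{-m}` leaves `2^{-m}`; `ρ` is its rate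
  -- after a `p`-th root.
  set ρ : ℝ := (1 / 2) ^ (1 / (p : ℝ)) with hρ
  have hp' : (0 : ℝ) < p := by positivity
  have hρ0 : 0 < ρ := by positivity
  have hρ1 : ρ < 1 := Real.rpow_lt_one (by norm_num) (by norm_num) (by positivity)
  have hρp : ρ ^ p = 1 / 2 := by
    rw [hρ, ← Real.rpow_natCast, ← Real.rpow_mul (by norm_num), one_div_mul_cancel hp'.ne',
      Real.rpow_one]
  have key (t : ℝ) (ht : 0 ≤ t) (m k : ℕ) (hk : (k : ℝ) ≤ 2 ^ m * t) :
      |g ((k + 1) / 2 ^ m) - g (k / 2 ^ m)| ≤ (1 + S) * (t + 2) ^ 2 * ρ ^ m := by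
    refine (pow_le_pow_iff_left₀ (abs_nonneg _) (by positivity) hp).1 ((h m k).trans ?_)
    have e1 : ((k : ℝ) + 1) ^ 2 ≤ 4 ^ m * (t + 2) ^ 2 := by
      have h1 : (1 : ℝ) ≤ 2 ^ m := one_le_pow₀ (by norm_num)
      have : (k : ℝ) + 1 ≤ 2 ^ m * (t + 2) := by nlinarith
      calc ((k : ℝ) + 1) ^ 2 ≤ (2 ^ m * (t + 2)) ^ 2 := by gcongr
        _ = 4 ^ m * (t + 2) ^ 2 := by rw [mul_pow, ← pow_mul, mul_comm m, pow_mul]; norm_num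
    -- Using `1 + S` instead of `S` makes the base at least one, so that no `p`-th root of it is
    -- needed.
    have e2 : (1 + S) * (t + 2) ^ 2 ≤ ((1 + S) * (t + 2) ^ 2) ^ p := by
      refine le_self_pow₀ ?_ hp
      nlinarith [mul_nonneg hS (sq_nonneg (t + 2))]
    calc S * (((k : ℝ) + 1) ^ 2 / 8 ^ m) ≤ S * (4 ^ m * (t + 2) ^ 2 / 8 ^ m) := by gcongr
      _ = S * (t + 2) ^ 2 * (1 / 2) ^ m := by
          rw [show (8 : ℝ) = 4 * 2 by norm_num, mul_pow, one_div, inv_pow]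
          field_simp
      _ ≤ (1 + S) * (t + 2) ^ 2 * (1 / 2) ^ m := by gcongr; linarith
      _ ≤ ((1 + S) * (t + 2) ^ 2) ^ p * (1 / 2) ^ m := by gcongr
      _ = ((1 + S) * (t + 2) ^ 2 * ρ ^ m) ^ p := by
          rw [mul_pow _ (ρ ^ m), ← hρp, ← pow_mul, ← pow_mul, mul_comm p m]
  refine ⟨|g 0| + (1 + S) + (1 + S) / (1 - ρ), fun t ht ↦ ?_⟩
  have hρ' : 0 < 1 - ρ := by linarith
  have h₁ := abs_sub_floor_le_of_dyadic hg ht (by positivity) hρ0.le hρ1 (key t ht)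
  -- Between integers, the increments of level `m = 0` are summed: there are at most `t` of them.
  have h₂ : |g ⌊t⌋₊ - g 0| ≤ t * ((1 + S) * (t + 2) ^ 2) := by
    have : ∀ n : ℕ, (n : ℝ) ≤ t → |g n - g 0| ≤ n * ((1 + S) * (t + 2) ^ 2) := by
      intro n
      induction n with
      | zero => intro _; simp
      | succ n ih =>
        intro hn
        push_cast at hn ⊢
        have h3 := key t ht 0 n (by simp; linarith)
        simp only [pow_zero, div_one, mul_one] at h3
        have h4 := abs_sub_le (g ((n : ℝ) + 1)) (g n) (g 0)
        have h5 := ih (by linarith)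
        linarith
    exact (this _ (Nat.floor_le ht)).trans
      (mul_le_mul_of_nonneg_right (Nat.floor_le ht) (by positivity))
  have h₃ : |g t| ≤ |g t - g ⌊t⌋₊| + |g ⌊t⌋₊ - g 0| + |g 0| := by
    have := abs_add_three (g t - g ⌊t⌋₊) (g ⌊t⌋₊ - g 0) (g 0)
    simpa using this
  have h₄ : (1 : ℝ) ≤ (t + 2) ^ 3 := one_le_pow₀ (by linarith)
  have h₅ : (1 + S) * (t + 2) ^ 2 / (1 - ρ) ≤ (1 + S) / (1 - ρ) * (t + 2) ^ 3 := by
    rw [div_mul_eq_mul_div]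
    gcongr
    · linarith
    · norm_num
  have h₆ : t * ((1 + S) * (t + 2) ^ 2) ≤ (1 + S) * (t + 2) ^ 3 := by
    have : 0 ≤ (1 + S) * (t + 2) ^ 2 := by positivity
    nlinarith
  nlinarith [abs_nonneg (g 0)]

theorem isBigO_atBot_of_abs_comp_neg_le {g : ℝ → ℝ} {C : ℝ}
    (h : ∀ t ≥ 0, |g (-t)| ≤ C * (t + 2) ^ 3) {c : ℝ} (hc : 0 < c) :
    g =O[atBot] fun s ↦ Real.exp (-c * s) := by
  have h₁ : (fun t : ℝ ↦ g (-t)) =O[atTop] fun t ↦ (t + 2) ^ 3 := by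
    refine Asymptotics.IsBigO.of_bound C ?_
    filter_upwards [eventually_ge_atTop 0] with t ht
    rw [Real.norm_eq_abs, Real.norm_eq_abs, abs_of_nonneg (by positivity : 0 ≤ (t + 2) ^ 3)]
    exact h t ht
  have h₂ : (fun t : ℝ ↦ (t + 2) ^ 3) =O[atTop] fun t ↦ Real.exp (c * t) := by
    have := (isLittleO_pow_exp_pos_mul_atTop 3 hc).isBigO.comp_tendsto
      (tendsto_atTop_add_const_right atTop (2 : ℝ) tendsto_id)
    refine this.trans (Asymptotics.IsBigO.of_bound (Real.exp (c * 2)) (Eventually.of_forall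
      fun t ↦ le_of_eq ?_))
    simp only [Function.comp, Real.norm_eq_abs, Real.abs_exp, ← Real.exp_add, id]
    ring_nf
  have := (h₁.trans h₂).comp_tendsto tendsto_neg_atBot_atTop
  simpa [Function.comp_def] using this

/-! ### Increments, growth and a regular version of fractional Brownian motion. -/

namespace IsFractionalBrownianMotion

variable {Ω : Type*} [MeasurableSpace Ω] {P : Measure Ω} {H : ℝ} {B : ℝ → Ω → ℝ}

theorem memLp_two (hB : IsFractionalBrownianMotion H B P) (t : ℝ) : MemLp (B t) 2 P :=
  (hB.isGaussianProcess.hasGaussianLaw_eval t).memLp_two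

theorem integrable_mul (hB : IsFractionalBrownianMotion H B P) (s t : ℝ) :
    Integrable (fun ω ↦ B s ω * B t ω) P :=
  (hB.memLp_two s).integrable_mul (hB.memLp_two t)

theorem integral_increment_mul_increment (hB : IsFractionalBrownianMotion H B P) (a b c d : ℝ) :
    ∫ ω, (B a ω - B b ω) * (B c ω - B d ω) ∂P
      = 1 / 2 * (|a - d| ^ (2 * H) + |b - c| ^ (2 * H) - |a - c| ^ (2 * H)
        - |b - d| ^ (2 * H)) := by
  have e : ∀ ω, (B a ω - B b ω) * (B c ω - B d ω)
      = (B a ω * B c ω - B a ω * B d ω) - (B b ω * B c ω - B b ω * B d ω) := fun ω ↦ by ring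
  simp_rw [e]
  have i := hB.integrable_mul
  have i₂ (a b c d : ℝ) : Integrable (fun ω ↦ B a ω * B b ω - B c ω * B d ω) P :=
    (i a b).sub (i c d)
  rw [integral_sub (i₂ _ _ _ _) (i₂ _ _ _ _), integral_sub (i _ _) (i _ _),
    integral_sub (i _ _) (i _ _), hB.covariance, hB.covariance, hB.covariance, hB.covariance]
  ring

theorem integral_increment_sq (hB : IsFractionalBrownianMotion H B P) (hH : 0 < H) (a b : ℝ) :
    ∫ ω, (B a ω - B b ω) ^ 2 ∂P = |a - b| ^ (2 * H) := by
  simp_rw [sq, hB.integral_increment_mul_increment, sub_self, abs_zero, abs_sub_comm b a]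
  rw [Real.zero_rpow (by positivity)]
  ring

theorem integral_increment_pow (hB : IsFractionalBrownianMotion H B P) (hH : 0 < H) (a b : ℝ)
    (k : ℕ) :
    ∫ ω, (B a ω - B b ω) ^ (2 * k) ∂P
      = ((2 * k)! : ℝ) / (2 ^ k * (k ! : ℝ)) * (|a - b| ^ (2 * H)) ^ k := by
  have hint (t : ℝ) := (hB.isGaussianProcess.hasGaussianLaw_eval t).integrable
  rw [integral_pow_two_mul_of_hasGaussianLaw hB.isGaussianProcess.hasGaussianLaw_fun_sub ?_,
    hB.integral_increment_sq hH]
  rw [integral_sub (hint a) (hint b), hB.centered, hB.centered, sub_zero]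

/-- The Gaussian moment of order `2q` of an increment of length `2^{-m}` is at most a constant times
`16^{-m}`. With weights `8^m/(k+1)²` the expectations are summable, so the weighted sum `S` is
almost surely finite and dominates each of its terms. -/
theorem ae_exists_dyadic_bound (hB : IsFractionalBrownianMotion H B P) (hH : 0 < H) :
    ∃ p : ℕ, p ≠ 0 ∧ ∀ᵐ ω ∂P, ∃ S : ℝ, ∀ m k : ℕ,
      |B (-((k + 1) / 2 ^ m)) ω - B (-(k / 2 ^ m)) ω| ^ p ≤ S * ((k + 1) ^ 2 / 8 ^ m) := by
  -- This makes `2Hq ≥ 4`, so that `(2^{-m})^{2Hq} ≤ 16^{-m}`.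
  obtain ⟨q, hq⟩ := exists_nat_gt (2 / H)
  have hq0 : q ≠ 0 := by
    rintro rfl
    have : 0 < 2 / H := by positivity
    norm_num at hq
    linarith
  have hqH : 4 ≤ 2 * H * q := by
    rw [div_lt_iff₀ hH] at hq
    linarith
  refine ⟨2 * q, by omega, ?_⟩
  set Δ : ℕ × ℕ → Ω → ℝ := fun mk ω ↦
    B (-((mk.2 + 1) / 2 ^ mk.1)) ω - B (-(mk.2 / 2 ^ mk.1)) ω with hΔ
  set w : ℕ × ℕ → ℝ := fun mk ↦ 8 ^ mk.1 / (mk.2 + 1) ^ 2 with hw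
  have hw0 (mk : ℕ × ℕ) : 0 < w mk := by positivity
  set c : ℝ := ((2 * q)! : ℝ) / (2 ^ q * (q ! : ℝ)) with hc
  have hgauss (mk : ℕ × ℕ) : HasGaussianLaw (Δ mk) P :=
    hB.isGaussianProcess.hasGaussianLaw_fun_sub
  have hint (mk : ℕ × ℕ) : Integrable (fun ω ↦ w mk * Δ mk ω ^ (2 * q)) P := by
    refine Integrable.const_mul ?_ _
    have := ((hgauss mk).memLp (p := ((2 * q : ℕ) : ENNReal)) (ENNReal.natCast_ne_top _)).integrable_norm_pow
      (by omega)
    refine this.congr (Eventually.of_forall fun ω ↦ ?_)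
    simp only [Real.norm_eq_abs]
    exact (even_two_mul q).pow_abs _
  have hmom (mk : ℕ × ℕ) :
      ∫ ω, w mk * Δ mk ω ^ (2 * q) ∂P ≤ c * ((1 / 2) ^ mk.1 * (1 / ((mk.2 : ℝ) + 1) ^ 2)) := by
    rw [integral_const_mul, hB.integral_increment_pow hH, ← hc]
    have e : |(-(((mk.2 : ℝ) + 1) / 2 ^ mk.1) - -((mk.2 : ℝ) / 2 ^ mk.1))| = (1 / 2) ^ mk.1 := by
      rw [show (-(((mk.2 : ℝ) + 1) / 2 ^ mk.1) - -((mk.2 : ℝ) / 2 ^ mk.1)) = -(1 / 2) ^ mk.1 by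
        rw [one_div_pow]; ring, abs_neg, abs_of_pos (by positivity)]
    rw [e, ← Real.rpow_natCast (((1 / 2 : ℝ) ^ mk.1) ^ (2 * H)) q, ← Real.rpow_mul (by positivity)]
    have h16 : ((1 / 2 : ℝ) ^ mk.1) ^ (2 * H * q) ≤ (1 / 16) ^ mk.1 := by
      calc ((1 / 2 : ℝ) ^ mk.1) ^ (2 * H * q) ≤ ((1 / 2 : ℝ) ^ mk.1) ^ (4 : ℝ) :=
            Real.rpow_le_rpow_of_exponent_ge (by positivity)
              (pow_le_one₀ (by norm_num) (by norm_num)) hqH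
        _ = (1 / 16) ^ mk.1 := by
            rw [show (4 : ℝ) = ((4 : ℕ) : ℝ) by norm_num, Real.rpow_natCast, ← pow_mul, mul_comm,
              pow_mul]
            norm_num
    have hc0 : 0 ≤ c := by positivity
    calc w mk * (c * ((1 / 2 : ℝ) ^ mk.1) ^ (2 * H * q)) ≤ w mk * (c * (1 / 16) ^ mk.1) := by
          have := (hw0 mk).le
          gcongr
      _ = c * ((1 / 2) ^ mk.1 * (1 / ((mk.2 : ℝ) + 1) ^ 2)) := by
          rw [hw, show (1 / 16 : ℝ) = 1 / 8 * (1 / 2) by norm_num, mul_pow, one_div_pow 8]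
          field_simp
  have hsum : Summable fun mk : ℕ × ℕ ↦ c * ((1 / 2 : ℝ) ^ mk.1 * (1 / ((mk.2 : ℝ) + 1) ^ 2)) := by
    refine Summable.mul_left _ (Summable.mul_of_nonneg (f := fun m : ℕ ↦ (1 / 2 : ℝ) ^ m)
      (g := fun k : ℕ ↦ 1 / ((k : ℝ) + 1) ^ 2) summable_geometric_two ?_
      (fun _ ↦ by positivity) (fun _ ↦ by positivity))
    have := (summable_nat_add_iff 1).2 (Real.summable_one_div_nat_pow.2 one_lt_two)
    simpa using this
  have hfin : ∫⁻ ω, ∑' mk, ENNReal.ofReal (w mk * Δ mk ω ^ (2 * q)) ∂P ≠ ⊤ := by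
    rw [lintegral_tsum fun mk ↦ (hint mk).aemeasurable.ennreal_ofReal]
    refine ne_top_of_le_ne_top hsum.tsum_ofReal_ne_top (ENNReal.tsum_le_tsum fun mk ↦ ?_)
    rw [← ofReal_integral_eq_lintegral_ofReal (hint mk)
      (Eventually.of_forall fun ω ↦ mul_nonneg (hw0 mk).le ((even_two_mul q).pow_nonneg _))]
    exact ENNReal.ofReal_le_ofReal (hmom mk)
  have hmeas : AEMeasurable (fun ω ↦ ∑' mk, ENNReal.ofReal (w mk * Δ mk ω ^ (2 * q))) P :=
    AEMeasurable.tsum fun mk ↦ (hint mk).aemeasurable.ennreal_ofReal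
  filter_upwards [ae_lt_top' hmeas hfin] with ω hω
  refine ⟨(∑' mk, ENNReal.ofReal (w mk * Δ mk ω ^ (2 * q))).toReal, fun m k ↦ ?_⟩
  have h₁ := ENNReal.toReal_mono hω.ne
    (ENNReal.le_tsum (f := fun mk ↦ ENNReal.ofReal (w mk * Δ mk ω ^ (2 * q))) (m, k))
  rw [ENNReal.toReal_ofReal (mul_nonneg (hw0 _).le ((even_two_mul q).pow_nonneg _))] at h₁
  rw [(even_two_mul q).pow_abs, ← div_le_iff₀ (by positivity), div_div_eq_mul_div, mul_div_assoc,
    mul_comm]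
  exact h₁

theorem ae_isBigO_exp (hB : IsFractionalBrownianMotion H B P) (hH : 0 < H) {c : ℝ} (hc : 0 < c) :
    ∀ᵐ ω ∂P, (fun s ↦ B s ω) =O[atBot] fun s ↦ Real.exp (-c * s) := by
  obtain ⟨p, hp, h⟩ := hB.ae_exists_dyadic_bound hH
  filter_upwards [h, hB.continuous_paths] with ω ⟨S, hS⟩ hω
  obtain ⟨C, hC⟩ := exists_forall_abs_le_of_dyadic (g := fun t ↦ B (-t) ω) (by fun_prop) hp hS
  exact isBigO_atBot_of_abs_comp_neg_le hC hc

/-- A fractional Brownian motion agrees, outside a null set, with one all of whose coordinates are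
measurable and all of whose paths are continuous and of subexponential growth. -/
theorem exists_regular_version (hB : IsFractionalBrownianMotion H B P) (hH : 0 < H) {c : ℝ}
    (hc : 0 < c) :
    ∃ B' : ℝ → Ω → ℝ, IsFractionalBrownianMotion H B' P ∧ (∀ t, Measurable (B' t)) ∧
      (∀ ω, Continuous fun t ↦ B' t ω) ∧
      (∀ ω, (fun s ↦ B' s ω) =O[atBot] fun s ↦ Real.exp (-c * s)) ∧
      ∀ᵐ ω ∂P, ∀ t, B' t ω = B t ω := by
  classical
  have hmeas := fun t ↦ hB.isGaussianProcess.aemeasurable t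
  -- The coordinates are only almost everywhere measurable. Countably many of them can be replaced
  -- off one null set; real times follow by continuity.
  have hq : ∀ᵐ ω ∂P, ∀ q : ℚ, B q ω = (hmeas q).mk _ ω := ae_all_iff.2 fun q ↦ (hmeas q).ae_eq_mk
  set G : Set Ω := {ω | (Continuous fun t ↦ B t ω) ∧
    ((fun s ↦ B s ω) =O[atBot] fun s ↦ Real.exp (-c * s)) ∧
    ∀ q : ℚ, B q ω = (hmeas q).mk _ ω} with hG
  have hGae : ∀ᵐ ω ∂P, ω ∈ G := by
    filter_upwards [hB.continuous_paths, hB.ae_isBigO_exp hH hc, hq] with ω h₁ h₂ h₃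
    exact ⟨h₁, h₂, h₃⟩
  -- The good set need not be measurable, hence a measurable null set containing its complement, on
  -- which the path is set to zero.
  set N := toMeasurable P Gᶜ with hN
  have hNm : MeasurableSet N := measurableSet_toMeasurable _ _
  have hN0 : P N = 0 := by rw [hN, measure_toMeasurable]; exact hGae
  have hmem : ∀ ω ∉ N, ω ∈ G := fun ω hω ↦ by
    by_contra h
    exact hω (subset_toMeasurable _ _ h)
  have hNae : ∀ᵐ ω ∂P, ω ∉ N := measure_eq_zero_iff_ae_notMem.1 hN0
  set B' : ℝ → Ω → ℝ := fun t ω ↦ if ω ∈ N then 0 else B t ω with hB'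
  have hcont (ω : Ω) : Continuous fun t ↦ B' t ω := by
    by_cases hω : ω ∈ N
    · simpa [hB', hω] using continuous_const
    · simpa [hB', hω] using (hmem ω hω).1
  have hae : ∀ᵐ ω ∂P, ∀ t, B' t ω = B t ω := by
    filter_upwards [hNae] with ω hω t
    simp [hB', hω]
  have haet (t : ℝ) : B' t =ᵐ[P] B t := hae.mono fun ω h ↦ h t
  refine ⟨B', ⟨hB.isGaussianProcess.congr fun t ↦ (haet t).symm, fun t ↦ ?_, fun t s ↦ ?_,
    Eventually.of_forall hcont⟩, fun t ↦ ?_, hcont, fun ω ↦ ?_, hae⟩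
  · rw [integral_congr_ae (haet t), hB.centered]
  · rw [← hB.covariance]
    exact integral_congr_ae ((haet t).mul (haet s))
  · obtain ⟨x, hx, hxt⟩ := mem_closure_iff_seq_limit.1 (Rat.denseRange_cast (𝕜 := ℝ) t)
    choose u hu using hx
    obtain rfl : (fun n ↦ (u n : ℝ)) = x := funext hu
    have hrat (q : ℚ) : Measurable (B' q) := by
      have : B' q = fun ω ↦ if ω ∈ N then 0 else (hmeas q).mk _ ω := by
        ext ω
        by_cases hω : ω ∈ N
        · simp [hB', hω]
        · simpa [hB', hω] using (hmem ω hω).2.2 q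
      rw [this]
      exact Measurable.ite hNm measurable_const (hmeas q).measurable_mk
    exact measurable_of_tendsto_metrizable (fun n ↦ hrat (u n))
      (tendsto_pi_nhds.2 fun ω ↦ ((hcont ω).tendsto t).comp hxt)
  · by_cases hω : ω ∈ N
    · simpa [hB', hω] using Asymptotics.isBigO_zero _ _
    · simpa [hB', hω] using (hmem ω hω).2.1

end IsFractionalBrownianMotion

/-! ### Exponential averages of powers and the autocovariance function. -/

theorem abs_rpow_le_one_add_sq {a : ℝ} (ha0 : 0 ≤ a) (ha2 : a ≤ 2) (x : ℝ) :
    |x| ^ a ≤ 1 + x ^ 2 := by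
  rcases le_total |x| 1 with h | h
  · have := Real.rpow_le_one (abs_nonneg x) h ha0
    nlinarith [sq_nonneg x]
  · have := Real.rpow_le_rpow_of_exponent_le h ha2
    rw [Real.rpow_two, sq_abs] at this
    linarith

theorem isBigO_abs_rpow_exp_atBot {c : ℝ} (hc : 0 < c) (a : ℝ) :
    (fun s : ℝ ↦ |s| ^ a) =O[atBot] fun s ↦ Real.exp (-c * s) := by
  have := (isLittleO_rpow_exp_pos_mul_atTop a hc).isBigO.comp_tendsto tendsto_neg_atBot_atTop
  refine (this.congr' ?_ ?_)
  · filter_upwards [eventually_le_atBot 0] with s hs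
    simp [Function.comp, abs_of_nonpos hs]
  · exact Eventually.of_forall fun s ↦ by simp [Function.comp]

theorem continuous_abs_rpow {a : ℝ} (ha : 0 < a) : Continuous fun s : ℝ ↦ |s| ^ a :=
  continuous_abs.rpow_const fun _ ↦ Or.inr ha.le

theorem integrableOn_exp_neg_mul_abs_sub_rpow {a θ : ℝ} (ha : 0 < a) (hθ : 0 < θ) (t : ℝ) :
    IntegrableOn (fun w ↦ Real.exp (-θ * w) * |t - w| ^ a) (Set.Ioi 0) :=
  integrableOn_exp_neg_mul_comp_sub hθ (continuous_abs_rpow ha)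
    (isBigO_abs_rpow_exp_atBot (half_pos hθ) a) t

theorem integrableOn_exp_neg_mul_abs_add_rpow {a θ : ℝ} (ha : 0 < a) (hθ : 0 < θ) (t : ℝ) :
    IntegrableOn (fun w ↦ Real.exp (-θ * w) * |t + w| ^ a) (Set.Ioi 0) := by
  have := integrableOn_exp_neg_mul_abs_sub_rpow ha hθ (-t)
  refine this.congr_fun (fun w _ ↦ ?_) measurableSet_Ioi
  simp only
  rw [← abs_neg (-t - w)]
  ring_nf

theorem integrable_exp_neg_mul_abs_mul_abs_add_rpow {a θ : ℝ} (ha : 0 < a) (hθ : 0 < θ) (t : ℝ) :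
    Integrable fun w ↦ Real.exp (-θ * |w|) * |t + w| ^ a := by
  rw [← integrableOn_univ, ← Set.Iic_union_Ioi (a := (0 : ℝ)), integrableOn_union]
  constructor
  · have h := integrableOn_exp_neg_mul_abs_sub_rpow ha hθ t
    rw [integrableOn_Iic_iff_integrableOn_Iio, ← integrable_indicator_iff measurableSet_Iio]
    refine (h.integrable_indicator measurableSet_Ioi).comp_neg.congr
      (Eventually.of_forall fun w ↦ ?_)
    by_cases hw : w < 0
    · simp only
      rw [Set.indicator_of_mem (by simpa using hw), Set.indicator_of_mem (by simpa using hw),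
        abs_of_neg hw, sub_neg_eq_add]
    · simp only
      rw [Set.indicator_of_notMem (by simpa using hw), Set.indicator_of_notMem (by simpa using hw)]
  · refine (integrableOn_exp_neg_mul_abs_add_rpow ha hθ t).congr_fun (fun w hw ↦ ?_)
      measurableSet_Ioi
    simp only [abs_of_pos (Set.mem_Ioi.1 hw)]

theorem integral_exp_neg_mul_abs_mul_abs_add_rpow {a θ : ℝ} (ha : 0 < a) (hθ : 0 < θ) (t : ℝ) :
    ∫ w, Real.exp (-θ * |w|) * |t + w| ^ a
      = (∫ w in Set.Ioi 0, Real.exp (-θ * w) * |t + w| ^ a)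
        + ∫ w in Set.Ioi 0, Real.exp (-θ * w) * |t - w| ^ a := by
  have hi := integrable_exp_neg_mul_abs_mul_abs_add_rpow ha hθ t
  rw [← intervalIntegral.integral_Iic_add_Ioi (b := (0 : ℝ)) hi.integrableOn hi.integrableOn,
    add_comm]
  congr 1
  · refine setIntegral_congr_fun measurableSet_Ioi fun w hw ↦ ?_
    simp only [abs_of_pos (Set.mem_Ioi.1 hw)]
  · have := integral_comp_neg_Ioi 0 fun w ↦ Real.exp (-θ * |w|) * |t + w| ^ a
    rw [neg_zero] at this
    rw [← this]
    refine setIntegral_congr_fun measurableSet_Ioi fun w hw ↦ ?_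
    simp only [abs_neg, abs_of_pos (Set.mem_Ioi.1 hw), ← sub_eq_add_neg]

/-- The difference of two independent exponential variables is a Laplace variable. -/
theorem integral_integral_exp_neg_mul_abs_rpow {a θ : ℝ} (ha : 0 < a) (hθ : 0 < θ) (t : ℝ) :
    IntegrableOn (fun u ↦ ∫ v in Set.Ioi 0,
      Real.exp (-θ * u) * (Real.exp (-θ * v) * |t - u + v| ^ a)) (Set.Ioi 0) ∧
    ∫ u in Set.Ioi 0, ∫ v in Set.Ioi 0, Real.exp (-θ * u) * (Real.exp (-θ * v) * |t - u + v| ^ a)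
      = (2 * θ)⁻¹ * ∫ w, Real.exp (-θ * |w|) * |t + w| ^ a := by
  -- This is the integrand after the substitution `v = u + w`; the indicators encode `u > 0` and `v
  -- > 0`.
  set F : ℝ → ℝ → ℝ := fun u w ↦ (Set.Ioi 0).indicator (fun u ↦ (Set.Ioi 0).indicator
    (fun _ ↦ Real.exp (-θ * (2 * u + w)) * |t + w| ^ a) (u + w)) u with hF
  have h₁ : (Set.Ioi 0).indicator (fun u ↦ ∫ v in Set.Ioi 0,
      Real.exp (-θ * u) * (Real.exp (-θ * v) * |t - u + v| ^ a)) = fun u ↦ ∫ w, F u w := by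
    ext u
    by_cases hu : u ∈ Set.Ioi 0
    · simp only [hF, Set.indicator_of_mem hu]
      rw [← integral_indicator measurableSet_Ioi,
        ← integral_add_left_eq_self _ u]
      congr 1 with w
      by_cases hw : u + w ∈ Set.Ioi 0
      · rw [Set.indicator_of_mem hw, Set.indicator_of_mem hw, ← mul_assoc, ← Real.exp_add]
        ring_nf
      · rw [Set.indicator_of_notMem hw, Set.indicator_of_notMem hw]
    · simp [hF, Set.indicator_of_notMem hu]
  have hint : Integrable (Function.uncurry F) (volume.prod volume) := by
    -- Where `u > 0` and `u + w > 0`, one has `2u + w ≥ (u + |w|)/2`, which gives a dominating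
    -- function in product form.
    have hdom : Integrable (fun z : ℝ × ℝ ↦
        (Set.Ioi 0).indicator (fun u : ℝ ↦ Real.exp (-(θ / 2) * u)) z.1
          * (Real.exp (-(θ / 2) * |z.2|) * |t + z.2| ^ a)) (volume.prod volume) :=
      ((integrableOn_exp_neg_mul_Ioi (half_pos hθ)).integrable_indicator measurableSet_Ioi).mul_prod
        (integrable_exp_neg_mul_abs_mul_abs_add_rpow ha (half_pos hθ) t)
    refine hdom.mono' ?_ (Eventually.of_forall fun z ↦ ?_)
    · have hc := continuous_abs_rpow ha
      have : Function.uncurry F = (({z : ℝ × ℝ | 0 < z.1} ∩ {z | 0 < z.1 + z.2}).indicator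
          fun z ↦ Real.exp (-θ * (2 * z.1 + z.2)) * |t + z.2| ^ a) := by
        ext ⟨u, w⟩
        simp only [Function.uncurry, hF, Set.indicator_apply, Set.mem_Ioi, Set.mem_inter_iff,
          Set.mem_ofPred_eq]
        by_cases h1 : 0 < u <;> by_cases h2 : 0 < u + w <;> simp [h1, h2]
      rw [this]
      refine Measurable.aestronglyMeasurable (Measurable.indicator ?_ ?_)
      · exact ((by fun_prop : Continuous fun z : ℝ × ℝ ↦ Real.exp (-θ * (2 * z.1 + z.2))).mul
          (hc.comp (by fun_prop : Continuous fun z : ℝ × ℝ ↦ t + z.2))).measurable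
      · exact (measurableSet_lt measurable_const measurable_fst).inter
          (measurableSet_lt measurable_const (measurable_fst.add measurable_snd))
    · obtain ⟨u, w⟩ := z
      simp only [Function.uncurry, hF]
      by_cases hu : u ∈ Set.Ioi 0
      · by_cases hw : u + w ∈ Set.Ioi 0
        · rw [Set.indicator_of_mem hu, Set.indicator_of_mem hw, Set.indicator_of_mem hu,
            Real.norm_of_nonneg (by positivity), ← mul_assoc, ← Real.exp_add]
          gcongr
          rw [Set.mem_Ioi] at hu hw
          rcases abs_cases w with h | h <;> nlinarith
        · rw [Set.indicator_of_mem hu, Set.indicator_of_notMem hw, norm_zero]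
          have := Set.indicator_nonneg (s := Set.Ioi (0 : ℝ))
            (f := fun u : ℝ ↦ Real.exp (-(θ / 2) * u)) (fun x _ ↦ (Real.exp_pos _).le) u
          positivity
      · simp [Set.indicator_of_notMem hu]
  refine ⟨by
    rw [← integrable_indicator_iff measurableSet_Ioi, h₁]
    exact hint.integral_prod_left, ?_⟩
  rw [← integral_indicator measurableSet_Ioi, h₁, integral_integral_swap hint, ← integral_const_mul]
  congr 1 with w
  -- For fixed `w` the constraints amount to `u > max 0 (-w)`; integrating `e^{-2θu}` from there
  -- produces the Laplace kernel `e^{-θ|w|}/(2θ)`.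
  have h₂ (u : ℝ) : F u w = (Set.Ioi (max 0 (-w))).indicator
      (fun u ↦ Real.exp (-(2 * θ) * u)) u * (Real.exp (-θ * w) * |t + w| ^ a) := by
    simp only [hF]
    by_cases h : u ∈ Set.Ioi (max 0 (-w))
    · have h' := h
      rw [Set.mem_Ioi, max_lt_iff] at h'
      rw [Set.indicator_of_mem h, Set.indicator_of_mem (show u ∈ Set.Ioi 0 from h'.1),
        Set.indicator_of_mem (show u + w ∈ Set.Ioi 0 by rw [Set.mem_Ioi]; linarith), ← mul_assoc,
        ← Real.exp_add]
      ring_nf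
    · rw [Set.indicator_of_notMem h, zero_mul]
      rw [Set.mem_Ioi, max_lt_iff, not_and_or] at h
      by_cases hu : u ∈ Set.Ioi 0
      · rw [Set.indicator_of_mem hu, Set.indicator_of_notMem]
        rw [Set.mem_Ioi] at hu ⊢
        rcases h with h | h
        · exact absurd hu h
        · linarith
      · rw [Set.indicator_of_notMem hu]
  simp_rw [h₂]
  rw [integral_mul_const, integral_indicator measurableSet_Ioi,
    integral_exp_mul_Ioi (by linarith)]
  have h₃ : Real.exp (-(2 * θ) * max 0 (-w)) * Real.exp (-θ * w) = Real.exp (-θ * |w|) := by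
    rw [← Real.exp_add]
    congr 1
    rcases le_total 0 w with h | h
    · rw [max_eq_left (by linarith), abs_of_nonneg h]; ring
    · rw [max_eq_right (by linarith), abs_of_nonpos h]; ring
  rw [← h₃]
  field_simp

/-- The autocovariance of the stationary fractional Ornstein-Uhlenbeck process. -/
noncomputable def fouCov (H θ t : ℝ) : ℝ :=
  θ / 4 * ∫ w in Set.Ioi (0 : ℝ), Real.exp (-θ * w) *
    (|t + w| ^ (2 * H) + |t - w| ^ (2 * H) - 2 * |t| ^ (2 * H))

section

variable {H θ : ℝ}

theorem fouCov_neg (t : ℝ) : fouCov H θ (-t) = fouCov H θ t := by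
  have e₁ (w : ℝ) : |-t + w| = |t - w| := by rw [← abs_neg]; ring_nf
  have e₂ (w : ℝ) : |-t - w| = |t + w| := by rw [← abs_neg]; ring_nf
  simp only [fouCov, abs_neg, e₁, e₂, add_comm (|t - _| ^ (2 * H))]

theorem fouCov_abs (t : ℝ) : fouCov H θ |t| = fouCov H θ t := by
  rcases abs_choice t with h | h <;> rw [h]
  exact fouCov_neg t

theorem fouCov_zero (hH : 0 < H) (hθ : 0 < θ) :
    fouCov H θ 0 = H * Real.Gamma (2 * H) / θ ^ (2 * H) := by
  have h := Real.integral_rpow_mul_exp_neg_mul_Ioi (a := 2 * H + 1) (r := θ) (by linarith) hθ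
  have e : ∫ w in Set.Ioi (0 : ℝ), Real.exp (-θ * w) *
      (|0 + w| ^ (2 * H) + |0 - w| ^ (2 * H) - 2 * |(0 : ℝ)| ^ (2 * H))
      = 2 * ∫ w in Set.Ioi (0 : ℝ), w ^ (2 * H + 1 - 1) * Real.exp (-(θ * w)) := by
    rw [← integral_const_mul]
    refine setIntegral_congr_fun measurableSet_Ioi fun w hw ↦ ?_
    simp only [zero_add, zero_sub, abs_neg, abs_zero, abs_of_pos (Set.mem_Ioi.1 hw)]
    rw [Real.zero_rpow (by positivity)]
    ring_nf
  rw [fouCov, e, h, Real.Gamma_add_one (by positivity), Real.rpow_add (by positivity),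
    Real.rpow_one, Real.div_rpow zero_le_one hθ.le, Real.one_rpow]
  field_simp
  ring

/-- The terms depending on one lag average to one-sided integrals. The term in `t - u + v` averages
over the Laplace law, that is, to half the sum of the same two integrals, so half of them survives.
-/
theorem integral_integral_exp_neg_mul_increment_cov {a : ℝ} (ha : 0 < a) (hθ : 0 < θ) (t : ℝ) :
    ∫ u in Set.Ioi 0, Real.exp (-θ * u) * ∫ v in Set.Ioi 0, Real.exp (-θ * v) *
      (|t + v| ^ a + |t - u| ^ a - |t| ^ a - |t - u + v| ^ a)
      = 1 / (2 * θ) * ∫ w in Set.Ioi 0, Real.exp (-θ * w) *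
        (|t + w| ^ a + |t - w| ^ a - 2 * |t| ^ a) := by
  have iE := integrableOn_exp_neg_mul_Ioi hθ
  have hE := integral_exp_neg_mul_Ioi_zero hθ
  have iP := integrableOn_exp_neg_mul_abs_add_rpow ha hθ
  have iM := integrableOn_exp_neg_mul_abs_sub_rpow ha hθ
  set Ap := ∫ w in Set.Ioi 0, Real.exp (-θ * w) * |t + w| ^ a with hAp
  set Am := ∫ w in Set.Ioi 0, Real.exp (-θ * w) * |t - w| ^ a with hAm
  have hinner (u : ℝ) : ∫ v in Set.Ioi 0, Real.exp (-θ * v) *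
      (|t + v| ^ a + |t - u| ^ a - |t| ^ a - |t - u + v| ^ a)
      = Ap + θ⁻¹ * (|t - u| ^ a - |t| ^ a)
        - ∫ v in Set.Ioi 0, Real.exp (-θ * v) * |t - u + v| ^ a := by
    have e (v : ℝ) : Real.exp (-θ * v) * (|t + v| ^ a + |t - u| ^ a - |t| ^ a - |t - u + v| ^ a)
        = Real.exp (-θ * v) * |t + v| ^ a + Real.exp (-θ * v) * (|t - u| ^ a - |t| ^ a)
          - Real.exp (-θ * v) * |t - u + v| ^ a := by ring
    simp_rw [e]
    rw [integral_sub _ (iP _), integral_add (iP _) (iE.mul_const _), integral_mul_const, hE]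
    exact (iP _).add (iE.mul_const _)
  obtain ⟨iJ, hJ⟩ := integral_integral_exp_neg_mul_abs_rpow ha hθ t
  rw [integral_exp_neg_mul_abs_mul_abs_add_rpow ha hθ, ← hAp, ← hAm] at hJ
  simp_rw [integral_const_mul] at hJ iJ
  simp_rw [hinner]
  have e (u : ℝ) : Real.exp (-θ * u) * (Ap + θ⁻¹ * (|t - u| ^ a - |t| ^ a)
        - ∫ v in Set.Ioi 0, Real.exp (-θ * v) * |t - u + v| ^ a)
      = Real.exp (-θ * u) * (Ap - θ⁻¹ * |t| ^ a) + θ⁻¹ * (Real.exp (-θ * u) * |t - u| ^ a)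
        - Real.exp (-θ * u) * ∫ v in Set.Ioi 0, Real.exp (-θ * v) * |t - u + v| ^ a := by ring
  have e' (w : ℝ) : Real.exp (-θ * w) * (|t + w| ^ a + |t - w| ^ a - 2 * |t| ^ a)
      = Real.exp (-θ * w) * |t + w| ^ a + Real.exp (-θ * w) * |t - w| ^ a
        - Real.exp (-θ * w) * (2 * |t| ^ a) := by ring
  simp_rw [e, e']
  have i₁ (c : ℝ) : IntegrableOn (fun u ↦ Real.exp (-θ * u) * c
      + θ⁻¹ * (Real.exp (-θ * u) * |t - u| ^ a)) (Set.Ioi 0) :=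
    (iE.mul_const _).add ((iM t).const_mul _)
  have i₂ : IntegrableOn (fun w ↦ Real.exp (-θ * w) * |t + w| ^ a
      + Real.exp (-θ * w) * |t - w| ^ a) (Set.Ioi 0) := (iP t).add (iM t)
  rw [integral_sub (i₁ _) iJ,
    integral_add (iE.mul_const _) ((iM t).const_mul _), integral_mul_const, hE,
    integral_const_mul, hJ, ← hAm, integral_sub i₂ (iE.mul_const _),
    integral_add (iP t) (iM t), ← hAp, ← hAm, integral_mul_const, hE]
  field_simp
  ring

/-- The second difference of `|·|` at `t` vanishes for `w ≤ t` and equals `2(w - t)` beyond;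
shifting by `t` releases the factor `e^{-θt}`. -/
theorem fouCov_half (hθ : 0 < θ) {t : ℝ} (ht : 0 ≤ t) :
    fouCov (1 / 2) θ t = Real.exp (-θ * t) / (2 * θ) := by
  have e (w : ℝ) (hw : w ∈ Set.Ioi (0 : ℝ)) : Real.exp (-θ * w) *
      (|t + w| ^ (2 * (1 / 2) : ℝ) + |t - w| ^ (2 * (1 / 2) : ℝ) - 2 * |t| ^ (2 * (1 / 2) : ℝ))
      = (Set.Ioi t).indicator (fun w ↦ Real.exp (-θ * w) * (2 * (w - t))) w := by
    rw [Set.mem_Ioi] at hw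
    simp only [mul_one_div_cancel (two_ne_zero (α := ℝ)), Real.rpow_one]
    rw [abs_of_nonneg ht, abs_of_nonneg (by linarith : 0 ≤ t + w)]
    by_cases h : w ∈ Set.Ioi t
    · rw [Set.indicator_of_mem h, abs_of_neg (by rw [Set.mem_Ioi] at h; linarith)]
      ring
    · rw [Set.indicator_of_notMem h, abs_of_nonneg (by rw [Set.mem_Ioi] at h; linarith)]
      ring
  have h := Real.integral_rpow_mul_exp_neg_mul_Ioi (a := 2) (r := θ) (by norm_num) hθ
  rw [fouCov, setIntegral_congr_fun measurableSet_Ioi e, setIntegral_indicator measurableSet_Ioi,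
    Set.inter_eq_right.2 (Set.Ioi_subset_Ioi ht), ← integral_indicator measurableSet_Ioi,
    ← integral_add_left_eq_self _ t]
  have e₂ : (fun w ↦ (Set.Ioi t).indicator (fun w ↦ Real.exp (-θ * w) * (2 * (w - t))) (t + w))
      = (Set.Ioi 0).indicator fun w ↦
        (2 * Real.exp (-θ * t)) * (w ^ ((2 : ℝ) - 1) * Real.exp (-(θ * w))) := by
    ext w
    by_cases hw : w ∈ Set.Ioi 0
    · rw [Set.indicator_of_mem hw, Set.indicator_of_mem (by simpa using hw)]
      norm_num
      rw [mul_add, neg_add, Real.exp_add]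
      ring
    · rw [Set.indicator_of_notMem hw, Set.indicator_of_notMem (by simpa using hw)]
  rw [e₂, integral_indicator measurableSet_Ioi, integral_const_mul, h, Real.Gamma_two]
  norm_num
  field_simp
  norm_num

/-! ### Decay and asymptotics of the autocovariance. -/

/-- One application of L'Hôpital's rule leaves a symmetric first difference over `x`, whose limit is
a derivative at `0`. -/
theorem tendsto_second_difference_rpow (a : ℝ) :
    Tendsto (fun x : ℝ ↦ ((1 + x) ^ a + (1 - x) ^ a - 2) / x ^ 2) (𝓝[≠] 0) (𝓝 (a * (a - 1))) := by
  have hpos : ∀ᶠ x : ℝ in 𝓝 0, 0 < 1 + x ∧ 0 < 1 - x := by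
    filter_upwards [Ioo_mem_nhds (show (-1 : ℝ) < 0 by norm_num) (show (0 : ℝ) < 1 by norm_num)]
      with x hx
    exact ⟨by linarith [hx.1], by linarith [hx.2]⟩
  have hadd (b x : ℝ) (hx : 0 < 1 + x) :
      HasDerivAt (fun x : ℝ ↦ (1 + x) ^ b) (b * (1 + x) ^ (b - 1)) x := by
    simpa using ((hasDerivAt_id x).const_add 1).rpow_const (p := b) (Or.inl hx.ne')
  have hsub (b x : ℝ) (hx : 0 < 1 - x) :
      HasDerivAt (fun x : ℝ ↦ (1 - x) ^ b) (-(b * (1 - x) ^ (b - 1))) x := by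
    simpa using ((hasDerivAt_id x).const_sub 1).rpow_const (p := b) (Or.inl hx.ne')
  have hd : HasDerivAt (fun x : ℝ ↦ a / 2 * ((1 + x) ^ (a - 1) - (1 - x) ^ (a - 1)))
      (a * (a - 1)) 0 := by
    have := ((hadd (a - 1) 0 (by norm_num)).sub (hsub (a - 1) 0 (by norm_num))).const_mul (a / 2)
    refine this.congr_deriv ?_
    norm_num
    ring
  refine HasDerivAt.lhopital_zero_nhdsNE (f' := fun x ↦ a * (1 + x) ^ (a - 1)
    - a * (1 - x) ^ (a - 1)) (g' := fun x ↦ 2 * x) ?_ ?_ ?_ ?_ ?_ ?_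
  · filter_upwards [nhdsWithin_le_nhds hpos] with x hx
    exact (((hadd a x hx.1).add (hsub a x hx.2)).sub_const 2).congr_deriv (by ring)
  · exact Eventually.of_forall fun x ↦ by simpa using hasDerivAt_pow 2 x
  · filter_upwards [self_mem_nhdsWithin] with x hx
    simpa using hx
  · have : ContinuousAt (fun x : ℝ ↦ (1 + x) ^ a + (1 - x) ^ a - 2) 0 :=
      (((hadd a 0 (by norm_num)).add (hsub a 0 (by norm_num))).sub_const 2).continuousAt
    have h := this.tendsto
    norm_num at h
    exact h.mono_left nhdsWithin_le_nhds
  · have : Tendsto (fun x : ℝ ↦ x ^ 2) (𝓝 0) (𝓝 (0 ^ 2)) := (continuous_pow 2).tendsto 0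
    rw [zero_pow two_ne_zero] at this
    exact this.mono_left nhdsWithin_le_nhds
  · have := hd.tendsto_slope_zero
    refine this.congr' ?_
    filter_upwards [self_mem_nhdsWithin] with x hx
    have hx' : x ≠ 0 := hx
    simp
    field_simp

/-- Near `0` the limit of the quotient gives the bound; away from `0` the crude `|y|^a ≤ 1 + y²`
does, the constants being absorbed into a multiple of `x²`. Being global, the bound provides the
domination below. -/
theorem exists_abs_second_difference_rpow_le {a : ℝ} (ha0 : 0 ≤ a) (ha2 : a ≤ 2) :
    ∃ C, 0 ≤ C ∧ ∀ x : ℝ, |(|1 + x| ^ a + |1 - x| ^ a - 2)| ≤ C * x ^ 2 := by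
  have h := (tendsto_second_difference_rpow a).abs.eventually_le_const
    (show |a * (a - 1)| < |a * (a - 1)| + 1 by linarith)
  obtain ⟨δ, hδ, H⟩ := Metric.mem_nhdsWithin_iff.1 h
  set δ' := min δ 1 with hδ'
  have hδ'0 : 0 < δ' := lt_min hδ one_pos
  refine ⟨(|a * (a - 1)| + 1) + (2 + 6 / δ' ^ 2), by positivity, fun x ↦ ?_⟩
  have hx2 := sq_nonneg x
  rcases eq_or_ne x 0 with rfl | hx0
  · norm_num
  have hC : 0 ≤ |a * (a - 1)| + 1 := by positivity
  have hD : 0 ≤ 2 + 6 / δ' ^ 2 := by positivity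
  rcases lt_or_ge |x| δ' with hx | hx
  · have h₁ := H ⟨by simpa using hx.trans_le (min_le_left _ _), hx0⟩
    have h₂ := abs_lt.1 (hx.trans_le (min_le_right _ _))
    simp only [Set.mem_ofPred_eq] at h₁
    rw [abs_div, abs_of_nonneg hx2, div_le_iff₀ (by positivity)] at h₁
    rw [abs_of_pos (by linarith : 0 < 1 + x), abs_of_pos (by linarith : 0 < 1 - x)]
    nlinarith
  · have h₁ := abs_rpow_le_one_add_sq ha0 ha2 (1 + x)
    have h₂ := abs_rpow_le_one_add_sq ha0 ha2 (1 - x)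
    have h₃ := Real.rpow_nonneg (abs_nonneg (1 + x)) a
    have h₄ := Real.rpow_nonneg (abs_nonneg (1 - x)) a
    have h₅ : 6 ≤ 6 / δ' ^ 2 * x ^ 2 := by
      rw [div_mul_eq_mul_div, le_div_iff₀ (by positivity)]
      have : δ' ^ 2 ≤ x ^ 2 := by rw [← sq_abs x]; gcongr
      linarith
    rw [abs_le]
    constructor <;> nlinarith

theorem second_difference_rpow_scale (a : ℝ) {t : ℝ} (ht : 0 < t) (w : ℝ) :
    |t + w| ^ a + |t - w| ^ a - 2 * |t| ^ a
      = t ^ a * (|1 + w / t| ^ a + |1 - w / t| ^ a - 2) := by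
  have e₁ : t + w = t * (1 + w / t) := by field_simp
  have e₂ : t - w = t * (1 - w / t) := by field_simp
  rw [e₁, e₂, abs_mul, abs_mul, Real.mul_rpow (abs_nonneg _) (abs_nonneg _),
    Real.mul_rpow (abs_nonneg _) (abs_nonneg _), abs_of_pos ht]
  ring

theorem integrableOn_sq_mul_exp_neg_mul_Ioi (hθ : 0 < θ) :
    IntegrableOn (fun w : ℝ ↦ Real.exp (-θ * w) * w ^ 2) (Set.Ioi 0) := by
  have h := integrableOn_exp_neg_mul_abs_sub_rpow (a := 2) two_pos hθ 0
  refine h.congr_fun (fun w _ ↦ ?_) measurableSet_Ioi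
  simp

theorem integral_sq_mul_exp_neg_mul_Ioi (hθ : 0 < θ) :
    ∫ w in Set.Ioi (0 : ℝ), Real.exp (-θ * w) * w ^ 2 = 2 / θ ^ 3 := by
  have h := Real.integral_rpow_mul_exp_neg_mul_Ioi (a := 3) (r := θ) (by norm_num) hθ
  have e : Set.EqOn (fun w : ℝ ↦ w ^ ((3 : ℝ) - 1) * Real.exp (-(θ * w)))
      (fun w : ℝ ↦ Real.exp (-θ * w) * w ^ 2) (Set.Ioi 0) := fun w _ ↦ by
    norm_num
    ring
  rw [← setIntegral_congr_fun measurableSet_Ioi e, h, show (3 : ℝ) = 2 + 1 by norm_num,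
    Real.Gamma_add_one two_ne_zero, Real.Gamma_two, show (2 : ℝ) + 1 = (3 : ℕ) by norm_num,
    Real.rpow_natCast]
  field_simp

theorem rpow_sub_two_mul_sq (a : ℝ) {t : ℝ} (ht : 0 < t) : t ^ (a - 2) * t ^ 2 = t ^ a := by
  rw [← Real.rpow_two, ← Real.rpow_add ht]
  ring_nf

theorem exists_abs_fouCov_le (hH₀ : 0 < H) (hH₁ : H < 1) (hθ : 0 < θ) :
    ∃ K, 0 ≤ K ∧ ∀ t > 0, |fouCov H θ t| ≤ K * t ^ (2 * H - 2) := by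
  obtain ⟨C, hC0, hC⟩ := exists_abs_second_difference_rpow_le (a := 2 * H) (by linarith)
    (by linarith)
  refine ⟨θ / 4 * (C * (2 / θ ^ 3)), by positivity, fun t ht ↦ ?_⟩
  have h : ‖∫ w in Set.Ioi (0 : ℝ), Real.exp (-θ * w) *
      (|t + w| ^ (2 * H) + |t - w| ^ (2 * H) - 2 * |t| ^ (2 * H))‖
      ≤ ∫ w in Set.Ioi (0 : ℝ), C * t ^ (2 * H - 2) * (Real.exp (-θ * w) * w ^ 2) := by
    refine norm_integral_le_of_norm_le ((integrableOn_sq_mul_exp_neg_mul_Ioi hθ).const_mul _)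
      (Eventually.of_forall fun w ↦ ?_)
    rw [second_difference_rpow_scale _ ht, norm_mul, Real.norm_of_nonneg (Real.exp_pos _).le,
      Real.norm_eq_abs, abs_mul, abs_of_pos (Real.rpow_pos_of_pos ht _)]
    calc Real.exp (-θ * w) * (t ^ (2 * H) * |(|1 + w / t| ^ (2 * H) + |1 - w / t| ^ (2 * H) - 2)|)
        ≤ Real.exp (-θ * w) * (t ^ (2 * H) * (C * (w / t) ^ 2)) := by
          have := hC (w / t)
          gcongr
      _ = C * t ^ (2 * H - 2) * (Real.exp (-θ * w) * w ^ 2) := by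
          rw [← rpow_sub_two_mul_sq (2 * H) ht]
          field_simp
  rw [integral_const_mul, integral_sq_mul_exp_neg_mul_Ioi hθ, Real.norm_eq_abs] at h
  rw [fouCov, abs_mul, abs_of_pos (by positivity : 0 < θ / 4)]
  calc _ ≤ θ / 4 * (C * t ^ (2 * H - 2) * (2 / θ ^ 3)) := by gcongr
    _ = _ := by ring

theorem tendsto_fouCov_atTop (hH₀ : 0 < H) (hH₁ : H < 1) (hθ : 0 < θ) :
    Tendsto (fouCov H θ) atTop (𝓝 0) := by
  obtain ⟨K, -, hK⟩ := exists_abs_fouCov_le hH₀ hH₁ hθ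
  have h₁ : Tendsto (fun t : ℝ ↦ K * t ^ (2 * H - 2)) atTop (𝓝 0) := by
    have := (tendsto_rpow_neg_atTop (y := 2 - 2 * H) (by linarith)).const_mul K
    simpa using this
  refine squeeze_zero_norm' ?_ h₁
  filter_upwards [eventually_gt_atTop 0] with t ht using hK t ht

/-- After scaling by `t`, dominated convergence applies; the limit is `θ/4 · 2H(2H-1) · ∫ e^{-θw}
w²`, the last integral being `2/θ³`. For `H = 1/2` the limit is zero and carries no asymptotic
equivalence. -/
theorem tendsto_rpow_mul_fouCov (hH₀ : 0 < H) (hH₁ : H < 1) (hθ : 0 < θ) :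
    Tendsto (fun t ↦ fouCov H θ t / t ^ (2 * H - 2)) atTop
      (𝓝 (H * (2 * H - 1) / θ ^ 2)) := by
  obtain ⟨C, hC0, hC⟩ := exists_abs_second_difference_rpow_le (a := 2 * H) (by linarith)
    (by linarith)
  have hlim : Tendsto (fun t : ℝ ↦ ∫ w in Set.Ioi (0 : ℝ), Real.exp (-θ * w) *
      (t ^ 2 * (|1 + w / t| ^ (2 * H) + |1 - w / t| ^ (2 * H) - 2))) atTop
      (𝓝 (∫ w in Set.Ioi (0 : ℝ), 2 * H * (2 * H - 1) * (Real.exp (-θ * w) * w ^ 2))) := by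
    refine tendsto_integral_filter_of_dominated_convergence
      (fun w ↦ C * (Real.exp (-θ * w) * w ^ 2)) ?_ ?_
      ((integrableOn_sq_mul_exp_neg_mul_Ioi hθ).const_mul _) ?_
    · have hc := continuous_abs_rpow (a := 2 * H) (by linarith)
      refine Eventually.of_forall fun t ↦ Continuous.aestronglyMeasurable ?_
      exact (by fun_prop : Continuous fun w : ℝ ↦ Real.exp (-θ * w)).mul (continuous_const.mul
        (((hc.comp (by fun_prop : Continuous fun w ↦ 1 + w / t)).add
          (hc.comp (by fun_prop : Continuous fun w ↦ 1 - w / t))).sub continuous_const))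
    · filter_upwards [eventually_gt_atTop 0] with t ht
      refine Eventually.of_forall fun w ↦ ?_
      rw [norm_mul, Real.norm_of_nonneg (Real.exp_pos _).le, Real.norm_eq_abs, abs_mul,
        abs_of_pos (by positivity : 0 < t ^ 2)]
      calc Real.exp (-θ * w) * (t ^ 2 * |(|1 + w / t| ^ (2 * H) + |1 - w / t| ^ (2 * H) - 2)|)
          ≤ Real.exp (-θ * w) * (t ^ 2 * (C * (w / t) ^ 2)) := by
            have := hC (w / t)
            gcongr
        _ = C * (Real.exp (-θ * w) * w ^ 2) := by field_simp
    · refine (ae_restrict_mem measurableSet_Ioi).mono fun w hw ↦ ?_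
      rw [Set.mem_Ioi] at hw
      have h₁ : Tendsto (fun t : ℝ ↦ w / t) atTop (𝓝[≠] 0) := by
        refine tendsto_nhdsWithin_iff.2 ⟨tendsto_id.const_div_atTop w, ?_⟩
        filter_upwards [eventually_gt_atTop 0] with t ht
        exact (div_pos hw ht).ne'
      have h₂ := ((tendsto_second_difference_rpow (2 * H)).comp h₁).const_mul
        (Real.exp (-θ * w) * w ^ 2)
      rw [mul_comm (Real.exp (-θ * w) * w ^ 2)] at h₂
      refine h₂.congr' ?_
      filter_upwards [eventually_gt_atTop w] with t ht
      have ht0 : 0 < t := hw.trans ht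
      have h1 : w / t < 1 := (div_lt_one ht0).2 ht
      have h0 : 0 < w / t := div_pos hw ht0
      simp only [Function.comp]
      rw [abs_of_pos (by linarith : 0 < 1 + w / t), abs_of_pos (by linarith : 0 < 1 - w / t)]
      field_simp
  rw [integral_const_mul, integral_sq_mul_exp_neg_mul_Ioi hθ] at hlim
  have h := hlim.const_mul (θ / 4)
  rw [show θ / 4 * (2 * H * (2 * H - 1) * (2 / θ ^ 3)) = H * (2 * H - 1) / θ ^ 2 by
    field_simp; ring] at h
  refine h.congr' ?_
  filter_upwards [eventually_gt_atTop 0] with t ht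
  have hp := Real.rpow_pos_of_pos ht (2 * H - 2)
  rw [fouCov, mul_div_assoc, ← integral_div]
  congr 2 with w
  rw [second_difference_rpow_scale _ ht, ← rpow_sub_two_mul_sq (2 * H) ht]
  field_simp

end

/-! ### Almost sure limits of Gaussian variables and processes. -/

section

variable {Ω T : Type*} [MeasurableSpace Ω] {P : Measure Ω}

theorem tendsto_charFun_map_of_ae_tendsto [IsProbabilityMeasure P] {Y : ℕ → Ω → ℝ} {Z : Ω → ℝ}
    (hY : ∀ n, AEMeasurable (Y n) P) (hZ : AEMeasurable Z P)
    (h : ∀ᵐ ω ∂P, Tendsto (fun n ↦ Y n ω) atTop (𝓝 (Z ω))) (u : ℝ) :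
    Tendsto (fun n ↦ charFun (P.map (Y n)) u) atTop (𝓝 (charFun (P.map Z) u)) := by
  have e {W : Ω → ℝ} (hW : AEMeasurable W P) :
      charFun (P.map W) u = ∫ ω, Complex.exp (u * W ω * Complex.I) ∂P := by
    rw [charFun_apply_real, integral_map hW
      (Continuous.aestronglyMeasurable (by fun_prop))]
  simp_rw [e (hY _), e hZ]
  refine tendsto_integral_of_dominated_convergence (fun _ ↦ 1) (fun n ↦ ?_)
    (integrable_const 1) (fun n ↦ Eventually.of_forall fun ω ↦ ?_) ?_
  · have := (hY n).aestronglyMeasurable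
    exact (by fun_prop : Continuous fun x : ℝ ↦
      Complex.exp (u * x * Complex.I)).comp_aestronglyMeasurable this
  · rw [← Complex.ofReal_mul, Complex.norm_exp_ofReal_mul_I]
  · filter_upwards [h] with ω hω
    exact ((by fun_prop : Continuous fun x : ℝ ↦
      Complex.exp (u * x * Complex.I)).tendsto _).comp hω

/-- An almost sure limit of centered real Gaussian variables is a centered Gaussian variable. -/
theorem hasGaussianLaw_of_ae_tendsto [IsProbabilityMeasure P] {Y : ℕ → Ω → ℝ} {Z : Ω → ℝ}
    (hY : ∀ n, HasGaussianLaw (Y n) P) (hY0 : ∀ n, ∫ ω, Y n ω ∂P = 0)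
    (h : ∀ᵐ ω ∂P, Tendsto (fun n ↦ Y n ω) atTop (𝓝 (Z ω))) :
    HasGaussianLaw Z P ∧ ∫ ω, Z ω ∂P = 0 := by
  have hZm : AEMeasurable Z P := aemeasurable_of_tendsto_metrizable_ae' (fun n ↦ (hY n).aemeasurable) h
  have hprob : IsProbabilityMeasure (P.map Z) := Measure.isProbabilityMeasure_map hZm
  have hlim := tendsto_charFun_map_of_ae_tendsto (fun n ↦ (hY n).aemeasurable) hZm h
  set v : ℕ → ℝ := fun n ↦ ∫ ω, Y n ω ^ 2 ∂P with hv
  have hv0 (n : ℕ) : 0 ≤ v n := integral_nonneg fun ω ↦ sq_nonneg _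
  have hchar (n : ℕ) (u : ℝ) :
      charFun (P.map (Y n)) u = Complex.exp (-(v n * u ^ 2 / 2 : ℝ)) := by
    rw [map_eq_gaussianReal_of_centered (hY n) (hY0 n), charFun_gaussianReal,
      Real.coe_toNNReal _ (hv0 n)]
    push_cast
    ring_nf
  -- The limiting characteristic function is continuous with value one at `0`, hence nonzero at some
  -- `u₀ ≠ 0`. The logarithm of its modulus there recovers the limit of the variances.
  obtain ⟨u₀, hu₀, hφ⟩ : ∃ u₀ : ℝ, u₀ ≠ 0 ∧ charFun (P.map Z) u₀ ≠ 0 := by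
    have hc : Continuous (charFun (P.map Z)) := continuous_charFun
    have h1 : ∀ᶠ u in 𝓝 (0 : ℝ), charFun (P.map Z) u ≠ 0 :=
      hc.continuousAt.eventually_ne (by simp)
    have h2 : ∀ᶠ u in 𝓝[≠] (0 : ℝ), u ≠ 0 := self_mem_nhdsWithin
    exact (h2.and (h1.filter_mono nhdsWithin_le_nhds)).exists
  have hnorm := (hlim u₀).norm
  simp_rw [hchar, ← Complex.ofReal_neg, ← Complex.ofReal_exp, Complex.norm_real,
    Real.norm_of_nonneg (Real.exp_pos _).le] at hnorm
  have hlog := ((Real.continuousAt_log (norm_ne_zero_iff.2 hφ)).tendsto.comp hnorm)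
  simp only [Function.comp_def, Real.log_exp] at hlog
  obtain ⟨v', hv'⟩ : ∃ v', Tendsto v atTop (𝓝 v') := by
    refine ⟨_, (hlog.const_mul (-(2 / u₀ ^ 2))).congr fun n ↦ ?_⟩
    field_simp
  have hv'0 : 0 ≤ v' := ge_of_tendsto' hv' hv0
  have hlaw : P.map Z = gaussianReal 0 v'.toNNReal := by
    refine Measure.ext_of_charFun (funext fun u ↦ ?_)
    refine tendsto_nhds_unique (hlim u) ?_
    simp_rw [hchar]
    have e : charFun (gaussianReal 0 v'.toNNReal) u = Complex.exp (-(v' * u ^ 2 / 2 : ℝ)) := by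
      rw [charFun_gaussianReal, Real.coe_toNNReal _ hv'0]
      push_cast
      ring_nf
    rw [e]
    exact ((by fun_prop : Continuous fun x : ℝ ↦
      Complex.exp (-(x * u ^ 2 / 2 : ℝ))).tendsto v').comp hv'
  have hZ : HasGaussianLaw Z P := ⟨by rw [hlaw]; infer_instance⟩
  refine ⟨hZ, ?_⟩
  rw [← integral_map (f := fun x : ℝ ↦ x) hZm (by fun_prop), hlaw, integral_id_gaussianReal]

/-- A Gaussian process all of whose coordinates are centered. -/
structure IsCenteredGaussianProcess (X : T → Ω → ℝ) (P : Measure Ω) : Prop where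
  gaussian : IsGaussianProcess X P
  centered : ∀ t, ∫ ω, X t ω ∂P = 0

namespace IsCenteredGaussianProcess

variable {X : T → Ω → ℝ}

theorem congr {Y : T → Ω → ℝ} (hX : IsCenteredGaussianProcess X P) (h : ∀ t, X t =ᵐ[P] Y t) :
    IsCenteredGaussianProcess Y P :=
  ⟨hX.gaussian.congr h, fun t ↦ by rw [← integral_congr_ae (h t), hX.centered]⟩

theorem memLp_two (hX : IsCenteredGaussianProcess X P) (t : T) : MemLp (X t) 2 P :=
  (hX.gaussian.hasGaussianLaw_eval t).memLp_two

theorem integrable (hX : IsCenteredGaussianProcess X P) (t : T) : Integrable (X t) P :=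
  (hX.gaussian.hasGaussianLaw_eval t).integrable

theorem integral_clm (hX : IsCenteredGaussianProcess X P) {I : Finset T}
    (L : (I → ℝ) →L[ℝ] ℝ) : ∫ ω, L (I.restrict (X · ω)) ∂P = 0 := by
  classical
  have e (ω : Ω) : L (I.restrict (X · ω)) = ∑ i : I, X i ω * L (Pi.single i 1) := by
    conv_lhs => rw [pi_eq_sum_univ' (I.restrict (X · ω)), map_sum]
    simp [Finset.restrict]
  simp_rw [e]
  rw [integral_finsetSum _ fun i _ ↦ (hX.integrable _).mul_const _]
  simp [integral_mul_const, hX.centered]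

/-- Every linear functional of finitely many coordinates is an almost sure limit of centered real
Gaussians, so the scalar case suffices (Cramér-Wold). -/
theorem of_ae_tendsto [IsProbabilityMeasure P] {Y : ℕ → T → Ω → ℝ}
    (hY : ∀ n, IsCenteredGaussianProcess (Y n) P)
    (h : ∀ t, ∀ᵐ ω ∂P, Tendsto (fun n ↦ Y n t ω) atTop (𝓝 (X t ω))) :
    IsCenteredGaussianProcess X P := by
  have hXm (t : T) : AEMeasurable (X t) P :=
    aemeasurable_of_tendsto_metrizable_ae' (fun n ↦ (hY n).gaussian.aemeasurable t) (h t)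
  refine ⟨⟨fun I ↦ ⟨isGaussian_of_isGaussian_map fun L ↦ ?_⟩⟩, fun t ↦ ?_⟩
  · have hm : AEMeasurable (fun ω ↦ I.restrict (X · ω)) P :=
      aemeasurable_pi_lambda _ fun _ ↦ hXm _
    rw [AEMeasurable.map_map_of_aemeasurable (by fun_prop) hm]
    refine (hasGaussianLaw_of_ae_tendsto (Y := fun n ω ↦ L (I.restrict (Y n · ω)))
      (fun n ↦ ((hY n).gaussian.hasGaussianLaw I).map L)
      (fun n ↦ (hY n).integral_clm L) ?_).1.isGaussian_map
    have hall : ∀ᵐ ω ∂P, ∀ i : I, Tendsto (fun n ↦ Y n i ω) atTop (𝓝 (X i ω)) :=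
      ae_all_iff.2 fun i ↦ h i
    filter_upwards [hall] with ω hω
    exact (L.continuous.tendsto _).comp (tendsto_pi_nhds.2 hω)
  · exact (hasGaussianLaw_of_ae_tendsto
      (fun n ↦ (hY n).gaussian.hasGaussianLaw_eval t) (fun n ↦ (hY n).centered t) (h t)).2

end IsCenteredGaussianProcess

theorem HasRSIntegral.tendsto_sum_uniform {f g : ℝ → ℝ} {a b I : ℝ} (h : HasRSIntegral f g a b I) :
    Tendsto (fun n : ℕ ↦ ∑ i ∈ Finset.range (n + 1), f (a + i * ((b - a) / (n + 1 : ℕ))) *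
      (g (a + (i + 1 : ℕ) * ((b - a) / (n + 1 : ℕ))) - g (a + i * ((b - a) / (n + 1 : ℕ)))))
      atTop (𝓝 I) := by
  rw [Metric.tendsto_atTop]
  intro ε hε
  obtain ⟨δ, hδ, H⟩ := h.2 ε hε
  have hlim : Tendsto (fun n : ℕ ↦ (b - a) / ((n + 1 : ℕ) : ℝ)) atTop (𝓝 0) :=
    (tendsto_const_div_atTop_nhds_zero_nat (b - a)).comp (tendsto_add_atTop_nat 1)
  obtain ⟨N, hN⟩ := eventually_atTop.1 (hlim.eventually_lt_const hδ)
  refine ⟨N, fun n hn ↦ ?_⟩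
  have h0 : 0 ≤ (b - a) / ((n + 1 : ℕ) : ℝ) := div_nonneg (by linarith [h.1]) (by positivity)
  have hn1 : ((n + 1 : ℕ) : ℝ) ≠ 0 := by positivity
  have hlt := hN n hn
  rw [Real.dist_eq]
  refine H (n + 1) (fun i ↦ a + i * ((b - a) / (n + 1 : ℕ)))
    (fun i ↦ a + i * ((b - a) / (n + 1 : ℕ))) (by simp) (by field_simp; ring) fun i _ ↦ ?_
  refine ⟨le_rfl, ?_, ?_⟩ <;> push_cast at h0 hlt ⊢ <;> nlinarith

/-- Riemann sums are finite linear combinations of coordinates of `B`. Integrand and limits may vary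
with the index, so the integrals are jointly Gaussian. -/
theorem IsGaussianProcess.isCentered_of_hasRSIntegral {B : ℝ → Ω → ℝ}
    (hB : IsCenteredGaussianProcess B P) {f : T → ℝ → ℝ} {a b : T → ℝ} {I : T → Ω → ℝ}
    (hI : ∀ t ω, HasRSIntegral (f t) (fun s ↦ B s ω) (a t) (b t) (I t ω)) :
    IsCenteredGaussianProcess I P := by
  classical
  have := hB.gaussian.isProbabilityMeasure
  refine IsCenteredGaussianProcess.of_ae_tendsto (fun n ↦ ⟨?_, fun t ↦ ?_⟩)
    fun t ↦ Eventually.of_forall fun ω ↦ (hI t ω).tendsto_sum_uniform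
  · refine hB.gaussian.of_isGaussianProcess fun t ↦ ?_
    set x : ℕ → ℝ := fun i ↦ a t + i * ((b t - a t) / (n + 1 : ℕ)) with hx
    have hmem (i : ℕ) (hi : i < n + 2) : x i ∈ Finset.image x (Finset.range (n + 2)) :=
      Finset.mem_image_of_mem _ (Finset.mem_range.2 hi)
    refine ⟨Finset.image x (Finset.range (n + 2)), ∑ i : Fin (n + 1), f t (x i) •
      (ContinuousLinearMap.proj ⟨x (i + 1), hmem _ (by omega)⟩
        - ContinuousLinearMap.proj ⟨x i, hmem _ (by omega)⟩), fun ω ↦ ?_⟩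
    rw [Finset.sum_range]
    simp [hx, Finset.restrict]
  · have hsub (c p q : ℝ) : Integrable (fun ω ↦ c * (B p ω - B q ω)) P :=
      ((hB.integrable _).sub (hB.integrable _)).const_mul _
    rw [integral_finsetSum _ fun i _ ↦ hsub _ _ _]
    refine Finset.sum_eq_zero fun i _ ↦ ?_
    rw [integral_const_mul, integral_sub (hB.integrable _) (hB.integrable _), hB.centered,
      hB.centered, sub_zero, mul_zero]

theorem isCenteredGaussianProcess_fouZ {B : ℝ → Ω → ℝ} {θ : ℝ} (hθ : 0 < θ)
    (hB : IsCenteredGaussianProcess B P) (hc : ∀ ω, Continuous fun t ↦ B t ω)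
    (hgr : ∀ ω, (fun s ↦ B s ω) =O[atBot] fun s ↦ Real.exp (-(θ / 2) * s)) :
    IsCenteredGaussianProcess (fouZ θ B) P := by
  have := hB.gaussian.isProbabilityMeasure
  have hZ (t : ℝ) (ω : Ω) := hasRSIntegralIic_exp_sub hθ (hc ω) (hgr ω) t
  -- The cutoff `min (-n) t` keeps the lower limit below `t` for all `n` and `t` at once.
  refine IsCenteredGaussianProcess.of_ae_tendsto (Y := fun n t ω ↦
    rsIntegral (fun s ↦ Real.exp (-θ * (t - s))) (fun s ↦ B s ω) (min (-n) t) t) (fun n ↦ ?_)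
    fun t ↦ Eventually.of_forall fun ω ↦ ?_
  · refine IsGaussianProcess.isCentered_of_hasRSIntegral hB
      (f := fun t s ↦ Real.exp (-θ * (t - s))) (a := fun t ↦ min (-n) t) (b := fun t ↦ t)
      fun t ω ↦ ?_
    have h := hasRSIntegral_exp_sub (hc ω) θ t (min_le_right (-(n : ℝ)) t)
    rwa [h.rsIntegral_eq]
  · rw [fouZ, (hZ t ω).rsIntegralIic_eq]
    refine (hZ t ω).2.comp ?_
    refine tendsto_atBot_mono (fun n : ℕ ↦ min_le_left (-(n : ℝ)) t) ?_
    exact tendsto_neg_atTop_atBot.comp tendsto_natCast_atTop_atTop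

end

/-! ### The covariance of the stationary process. -/

section

variable {Ω : Type*} [MeasurableSpace Ω] {P : Measure Ω} {H θ : ℝ} {B : ℝ → Ω → ℝ}

theorem IsFractionalBrownianMotion.isCenteredGaussianProcess
    (hB : IsFractionalBrownianMotion H B P) : IsCenteredGaussianProcess B P :=
  ⟨hB.isGaussianProcess, hB.centered⟩

/-- Fubini with a general square-integrable `W` serves both factors of the covariance: `W = Z s`
replaces the first by increments, then `W = B t - B (t - u)` replaces the second. -/
theorem IsFractionalBrownianMotion.integral_fouZ_mul (hH : 0 < H) (hθ : 0 < θ)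
    (hB : IsFractionalBrownianMotion H B P) (hm : ∀ t, Measurable (B t))
    (hc : ∀ ω, Continuous fun t ↦ B t ω)
    (hgr : ∀ ω, (fun s ↦ B s ω) =O[atBot] fun s ↦ Real.exp (-(θ / 2) * s))
    {W : Ω → ℝ} (hW : MemLp W 2 P) (t : ℝ) :
    ∫ ω, fouZ θ B t ω * W ω ∂P
      = θ * ∫ u in Set.Ioi (0 : ℝ), Real.exp (-θ * u) * ∫ ω, W ω * (B t ω - B (t - u) ω) ∂P := by
  have := hB.isGaussianProcess.isProbabilityMeasure
  have hZ (ω : Ω) : fouZ θ B t ω * W ω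
      = θ * ∫ u in Set.Ioi (0 : ℝ), Real.exp (-θ * u) * (W ω * (B t ω - B (t - u) ω)) := by
    rw [fouZ, (hasRSIntegralIic_exp_sub hθ (hc ω) (hgr ω) t).rsIntegralIic_eq, mul_assoc,
      ← integral_mul_const]
    congr 2 with u
    ring
  have hD (u : ℝ) : MemLp (fun ω ↦ B t ω - B (t - u) ω) 2 P :=
    (hB.memLp_two t).sub (hB.memLp_two (t - u))
  have hWD (u : ℝ) : Integrable (fun ω ↦ W ω * (B t ω - B (t - u) ω)) P := hW.integrable_mul (hD u)
  have hBm : Measurable (Function.uncurry B) :=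
    measurable_uncurry_of_continuous_of_measurable hc hm
  have hmeas : AEStronglyMeasurable (Function.uncurry fun ω u ↦
      Real.exp (-θ * u) * (W ω * (B t ω - B (t - u) ω)))
      (P.prod (volume.restrict (Set.Ioi 0))) := by
    have h₁ : Measurable fun z : Ω × ℝ ↦ Real.exp (-θ * z.2) := by fun_prop
    have h₂ : Measurable fun z : Ω × ℝ ↦ B t z.1 - B (t - z.2) z.1 :=
      ((hm t).comp measurable_fst).sub
        (hBm.comp ((measurable_const.sub measurable_snd).prodMk measurable_fst))
    exact h₁.aestronglyMeasurable.mul (hW.1.comp_fst.mul h₂.aestronglyMeasurable)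
  have hint : Integrable (Function.uncurry fun ω u ↦
      Real.exp (-θ * u) * (W ω * (B t ω - B (t - u) ω)))
      (P.prod (volume.restrict (Set.Ioi 0))) := by
    refine (integrable_prod_iff' hmeas).2 ⟨Eventually.of_forall fun u ↦
      (hWD u).const_mul (Real.exp (-θ * u)), ?_⟩
    -- The dominating function comes from `|xy| ≤ (x² + y²)/2` and the variance `|u|^{2H}` of the
    -- increment.
    have hdom : IntegrableOn (fun u : ℝ ↦ 1 / 2 * (Real.exp (-θ * u) * (∫ ω, W ω ^ 2 ∂P)
        + Real.exp (-θ * u) * |0 - u| ^ (2 * H))) (Set.Ioi 0) :=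
      (((integrableOn_exp_neg_mul_Ioi hθ).mul_const _).add
        (integrableOn_exp_neg_mul_abs_sub_rpow (by positivity) hθ 0)).const_mul _
    refine hdom.mono' hmeas.norm.prod_swap.integral_prod_right' (Eventually.of_forall fun u ↦ ?_)
    rw [Real.norm_of_nonneg (integral_nonneg fun _ ↦ norm_nonneg _)]
    have hDsq : ∫ ω, (B t ω - B (t - u) ω) ^ 2 ∂P = |0 - u| ^ (2 * H) := by
      rw [hB.integral_increment_sq hH, sub_sub_cancel, zero_sub, abs_neg]
    calc ∫ ω, ‖Real.exp (-θ * u) * (W ω * (B t ω - B (t - u) ω))‖ ∂P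
        ≤ ∫ ω, Real.exp (-θ * u) * (1 / 2) * (W ω ^ 2 + (B t ω - B (t - u) ω) ^ 2) ∂P := by
          refine integral_mono (((hWD u).const_mul _).norm)
            ((hW.integrable_sq.add (hD u).integrable_sq).const_mul _) fun ω ↦ ?_
          simp only
          rw [norm_mul, Real.norm_of_nonneg (Real.exp_pos _).le, Real.norm_eq_abs, abs_mul,
            mul_assoc]
          refine mul_le_mul_of_nonneg_left ?_ (Real.exp_pos _).le
          nlinarith [sq_nonneg (|W ω| - |B t ω - B (t - u) ω|), sq_abs (W ω),
            sq_abs (B t ω - B (t - u) ω)]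
      _ = 1 / 2 * (Real.exp (-θ * u) * (∫ ω, W ω ^ 2 ∂P)
          + Real.exp (-θ * u) * |0 - u| ^ (2 * H)) := by
          rw [integral_const_mul, integral_add hW.integrable_sq (hD u).integrable_sq, hDsq]
          ring
  simp_rw [hZ]
  rw [integral_const_mul, integral_integral_swap hint]
  simp_rw [integral_const_mul]

theorem IsFractionalBrownianMotion.integral_fouZ_mul_fouZ (hH : 0 < H) (hθ : 0 < θ)
    (hB : IsFractionalBrownianMotion H B P) (hm : ∀ t, Measurable (B t))
    (hc : ∀ ω, Continuous fun t ↦ B t ω)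
    (hgr : ∀ ω, (fun s ↦ B s ω) =O[atBot] fun s ↦ Real.exp (-(θ / 2) * s)) (t s : ℝ) :
    ∫ ω, fouZ θ B t ω * fouZ θ B s ω ∂P = fouCov H θ (t - s) := by
  have hZ := isCenteredGaussianProcess_fouZ hθ hB.isCenteredGaussianProcess hc hgr
  rw [hB.integral_fouZ_mul hH hθ hm hc hgr (hZ.memLp_two s)]
  have e₁ (u : ℝ) := hB.integral_fouZ_mul hH hθ hm hc hgr
    ((hB.memLp_two t).sub (hB.memLp_two (t - u))) s
  simp only [Pi.sub_apply] at e₁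
  have e₂ (u v : ℝ) : ∫ ω, (B t ω - B (t - u) ω) * (B s ω - B (s - v) ω) ∂P
      = 1 / 2 * (|t - s + v| ^ (2 * H) + |t - s - u| ^ (2 * H) - |t - s| ^ (2 * H)
        - |t - s - u + v| ^ (2 * H)) := by
    rw [hB.integral_increment_mul_increment]
    ring_nf
  simp_rw [e₁, e₂]
  have e₃ (u : ℝ) : Real.exp (-θ * u) * (θ * ∫ v in Set.Ioi (0 : ℝ), Real.exp (-θ * v) *
      (1 / 2 * (|t - s + v| ^ (2 * H) + |t - s - u| ^ (2 * H) - |t - s| ^ (2 * H)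
        - |t - s - u + v| ^ (2 * H))))
      = θ / 2 * (Real.exp (-θ * u) * ∫ v in Set.Ioi (0 : ℝ), Real.exp (-θ * v) *
      (|t - s + v| ^ (2 * H) + |t - s - u| ^ (2 * H) - |t - s| ^ (2 * H)
        - |t - s - u + v| ^ (2 * H))) := by
    simp_rw [mul_left_comm (Real.exp (-θ * _)) (1 / 2 : ℝ)]
    rw [integral_const_mul]
    ring
  simp_rw [e₃]
  rw [integral_const_mul, integral_integral_exp_neg_mul_increment_cov (by positivity) hθ, fouCov]
  field_simp
  norm_num
  ring

end

/-! ### Gaussian vectors: covariance determines the law; vanishing cross-covariance decouples. -/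

section

variable {Ω ι T : Type*} [MeasurableSpace Ω] {P : Measure Ω}

namespace IsCenteredGaussianProcess

theorem comp_right {X : T → Ω → ℝ} (hX : IsCenteredGaussianProcess X P) (s : ι → T) :
    IsCenteredGaussianProcess (fun i ↦ X (s i)) P :=
  ⟨hX.gaussian.comp_right s, fun i ↦ hX.centered (s i)⟩

theorem integral_exp_sum [Fintype ι] {X : ι → Ω → ℝ} (hX : IsCenteredGaussianProcess X P)
    (c : ι → ℝ) :
    ∫ ω, Complex.exp ((∑ i, c i * X i ω : ℝ) * Complex.I) ∂P
      = Complex.exp (-((∑ i, ∑ j, c i * c j * ∫ ω, X i ω * X j ω ∂P) / 2 : ℝ)) := by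
  have hlaw : HasGaussianLaw (fun ω ↦ ∑ i, c i * X i ω) P :=
    (hX.gaussian.smul c).hasGaussianLaw_fun_sum (I := Finset.univ)
  have hint (i j : ι) : Integrable (fun ω ↦ X i ω * X j ω) P :=
    (hX.memLp_two i).integrable_mul (hX.memLp_two j)
  have h0 : ∫ ω, ∑ i, c i * X i ω ∂P = 0 := by
    rw [integral_finsetSum _ fun i _ ↦ (hX.integrable i).const_mul (c i)]
    simp [integral_const_mul, hX.centered]
  have h2 : ∫ ω, (∑ i, c i * X i ω) ^ 2 ∂P = ∑ i, ∑ j, c i * c j * ∫ ω, X i ω * X j ω ∂P := by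
    have e (ω : Ω) : (∑ i, c i * X i ω) ^ 2 = ∑ i, ∑ j, c i * c j * (X i ω * X j ω) := by
      rw [sq, Finset.sum_mul_sum]
      refine Finset.sum_congr rfl fun i _ ↦ Finset.sum_congr rfl fun j _ ↦ by ring
    simp_rw [e]
    rw [integral_finsetSum _ fun i _ ↦
      integrable_finsetSum _ fun j _ ↦ (hint i j).const_mul (c i * c j)]
    refine Finset.sum_congr rfl fun i _ ↦ ?_
    rw [integral_finsetSum _ fun j _ ↦ (hint i j).const_mul (c i * c j)]
    simp_rw [integral_const_mul]
  have hnn : 0 ≤ ∫ ω, (∑ i, c i * X i ω) ^ 2 ∂P := integral_nonneg fun ω ↦ sq_nonneg _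
  have h := charFun_apply_real (μ := P.map fun ω ↦ ∑ i, c i * X i ω) 1
  rw [integral_map hlaw.aemeasurable (Continuous.aestronglyMeasurable (by fun_prop)),
    map_eq_gaussianReal_of_centered hlaw h0, charFun_gaussianReal, Real.coe_toNNReal _ hnn, h2] at h
  simp only [Complex.ofReal_one, one_mul] at h
  rw [← h]
  push_cast
  ring_nf

/-- Centered Gaussian vectors with the same covariance have the same law. -/
theorem map_eq_of_covariance_eq [Fintype ι] {X Y : ι → Ω → ℝ}
    (hX : IsCenteredGaussianProcess X P) (hY : IsCenteredGaussianProcess Y P)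
    (h : ∀ i j, ∫ ω, X i ω * X j ω ∂P = ∫ ω, Y i ω * Y j ω ∂P) :
    P.map (fun ω i ↦ X i ω) = P.map (fun ω i ↦ Y i ω) := by
  classical
  have hXm : AEMeasurable (fun ω i ↦ X i ω) P :=
    aemeasurable_pi_lambda _ fun i ↦ hX.gaussian.aemeasurable i
  have hYm : AEMeasurable (fun ω i ↦ Y i ω) P :=
    aemeasurable_pi_lambda _ fun i ↦ hY.gaussian.aemeasurable i
  have := hX.gaussian.isProbabilityMeasure
  have e (L : StrongDual ℝ (ι → ℝ)) (x : ι → ℝ) : L x = ∑ i, L (Pi.single i 1) * x i := by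
    conv_lhs => rw [pi_eq_sum_univ' x, map_sum]
    simp [mul_comm]
  refine Measure.ext_of_charFunDual (funext fun L ↦ ?_)
  rw [charFunDual_apply, charFunDual_apply, integral_map hXm
    (Continuous.aestronglyMeasurable (by fun_prop)), integral_map hYm
    (Continuous.aestronglyMeasurable (by fun_prop))]
  have eX (ω : Ω) := e L (X · ω)
  have eY (ω : Ω) := e L (Y · ω)
  simp_rw [eX, eY]
  rw [hX.integral_exp_sum, hY.integral_exp_sum]
  simp_rw [h]

/-- If the cross-covariances of two copies of a centered Gaussian vector tend to zero, then the
copies become asymptotically independent. -/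
theorem tendsto_integral_mul_of_cross_covariance [Fintype ι] {X : ι → Ω → ℝ}
    {Y : ℕ → ι → Ω → ℝ} (hXY : ∀ n, IsCenteredGaussianProcess (Sum.elim X (Y n)) P)
    (hcov : ∀ n i j, ∫ ω, Y n i ω * Y n j ω ∂P = ∫ ω, X i ω * X j ω ∂P)
    (hcross : ∀ i j, Tendsto (fun n ↦ ∫ ω, X i ω * Y n j ω ∂P) atTop (𝓝 0))
    {f : (ι → ℝ) → ℝ} (hf : Continuous f) (hf1 : ∀ x, |f x| ≤ 1) :
    Tendsto (fun n ↦ ∫ ω, f (X · ω) * f (Y n · ω) ∂P) atTop (𝓝 ((∫ ω, f (X · ω) ∂P) ^ 2)) := by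
  have hP := (hXY 0).gaussian.isProbabilityMeasure
  have hX : IsCenteredGaussianProcess X P := (hXY 0).comp_right Sum.inl
  have hXm (i : ι) : AEMeasurable (X i) P := hX.gaussian.aemeasurable i
  set W : ℕ → Ω → EuclideanSpace ℝ (ι ⊕ ι) := fun n ω ↦
    WithLp.toLp 2 fun k ↦ Sum.elim X (Y n) k ω with hW
  -- The limiting law is that of two independent copies of `X`, realised on the product space.
  set W₀ : Ω × Ω → EuclideanSpace ℝ (ι ⊕ ι) := fun z ↦
    WithLp.toLp 2 fun k ↦ Sum.elim (fun i ↦ X i z.1) (fun i ↦ X i z.2) k with hW₀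
  have hWm (n : ℕ) : AEMeasurable (W n) P :=
    (PiLp.continuous_toLp 2 _).measurable.comp_aemeasurable
      (aemeasurable_pi_lambda _ fun k ↦ (hXY n).gaussian.aemeasurable k)
  have hW₀m : AEMeasurable W₀ (P.prod P) := by
    refine (PiLp.continuous_toLp 2 _).measurable.comp_aemeasurable
      (aemeasurable_pi_lambda _ fun k ↦ ?_)
    rcases k with i | i
    · exact (hXm i).comp_fst
    · exact (hXm i).comp_snd
  have := fun n ↦ Measure.isProbabilityMeasure_map (hWm n)
  have := Measure.isProbabilityMeasure_map hW₀m
  have hinner (x c : EuclideanSpace ℝ (ι ⊕ ι)) : inner ℝ x c = ∑ k, c k * x k := by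
    simp [PiLp.inner_apply]
  let ν : ℕ → ProbabilityMeasure (EuclideanSpace ℝ (ι ⊕ ι)) := fun n ↦ ⟨P.map (W n), inferInstance⟩
  let ν₀ : ProbabilityMeasure (EuclideanSpace ℝ (ι ⊕ ι)) := ⟨(P.prod P).map W₀, inferInstance⟩
  have hlim : Tendsto ν atTop (𝓝 ν₀) := by
    -- By Lévy's continuity theorem it is enough that the quadratic forms converge: the diagonal
    -- blocks are constant in `n`, the mixed ones vanish in the limit.
    refine ProbabilityMeasure.tendsto_of_tendsto_charFun fun c ↦ ?_
    have hn (n : ℕ) : charFun (P.map (W n)) c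
        = Complex.exp (-((∑ k, ∑ l, c k * c l *
          ∫ ω, Sum.elim X (Y n) k ω * Sum.elim X (Y n) l ω ∂P) / 2 : ℝ)) := by
      rw [charFun_apply, integral_map (hWm n) (Continuous.aestronglyMeasurable (by fun_prop)),
        ← (hXY n).integral_exp_sum]
      simp_rw [hinner, hW]
    have h₀ : charFun ((P.prod P).map W₀) c
        = Complex.exp (-((∑ i, ∑ j, c (Sum.inl i) * c (Sum.inl j) * ∫ ω, X i ω * X j ω ∂P) / 2 : ℝ))
        * Complex.exp
          (-((∑ i, ∑ j, c (Sum.inr i) * c (Sum.inr j) * ∫ ω, X i ω * X j ω ∂P) / 2 : ℝ)) := by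
      rw [charFun_apply, integral_map hW₀m (Continuous.aestronglyMeasurable (by fun_prop)),
        ← hX.integral_exp_sum fun i ↦ c (Sum.inl i), ← hX.integral_exp_sum fun i ↦ c (Sum.inr i),
        ← integral_prod_mul]
      congr 1 with z
      rw [hinner, Fintype.sum_sum_type, ← Complex.exp_add]
      simp only [hW₀, Sum.elim_inl, Sum.elim_inr]
      push_cast
      ring_nf
    simp only [ν, ν₀, ProbabilityMeasure.coe_mk]
    simp_rw [hn]
    rw [h₀, ← Complex.exp_add]
    refine (Complex.continuous_exp.tendsto _).comp ?_
    rw [← neg_add, ← Complex.ofReal_add, ← add_div]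
    refine (Complex.continuous_ofReal.neg.tendsto _).comp (Tendsto.div_const ?_ 2)
    simp only [Fintype.sum_sum_type, Sum.elim_inl, Sum.elim_inr, Finset.sum_add_distrib, hcov]
    have hz₁ : Tendsto (fun n ↦ ∑ i, ∑ j, c (Sum.inl i) * c (Sum.inr j) *
        ∫ ω, X i ω * Y n j ω ∂P) atTop (𝓝 0) := by
      have := tendsto_finsetSum Finset.univ fun i _ ↦ tendsto_finsetSum Finset.univ fun j _ ↦
        (hcross i j).const_mul (c (Sum.inl i) * c (Sum.inr j))
      simpa using this
    have hz₂ : Tendsto (fun n ↦ ∑ i, ∑ j, c (Sum.inr i) * c (Sum.inl j) *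
        ∫ ω, Y n i ω * X j ω ∂P) atTop (𝓝 0) := by
      have := tendsto_finsetSum Finset.univ fun i _ ↦ tendsto_finsetSum Finset.univ fun j _ ↦
        (hcross j i).const_mul (c (Sum.inr i) * c (Sum.inl j))
      simpa [mul_comm] using this
    have hfin := (tendsto_const_nhds (x := ∑ i, ∑ j, c (Sum.inl i) * c (Sum.inl j) *
      ∫ ω, X i ω * X j ω ∂P)).add hz₂ |>.add (hz₁.add (tendsto_const_nhds
      (x := ∑ i, ∑ j, c (Sum.inr i) * c (Sum.inr j) * ∫ ω, X i ω * X j ω ∂P)))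
    simpa using hfin
  set F : BoundedContinuousFunction (EuclideanSpace ℝ (ι ⊕ ι)) ℝ :=
    BoundedContinuousFunction.ofNormedAddCommGroup
      (fun x ↦ f (fun i ↦ x (Sum.inl i)) * f (fun i ↦ x (Sum.inr i)))
      ((hf.comp (by fun_prop)).mul (hf.comp (by fun_prop))) 1 (fun x ↦ by
        rw [Real.norm_eq_abs, abs_mul]
        exact mul_le_one₀ (hf1 _) (abs_nonneg _) (hf1 _)) with hF
  have h := ProbabilityMeasure.tendsto_iff_forall_integral_tendsto.1 hlim F
  simp only [ν, ν₀, ProbabilityMeasure.coe_mk] at h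
  have hFm : Continuous F := F.continuous
  simp_rw [integral_map (hWm _) hFm.aestronglyMeasurable] at h
  rw [integral_map hW₀m hFm.aestronglyMeasurable] at h
  have e₀ : ∫ z, F (W₀ z) ∂(P.prod P) = (∫ ω, f (X · ω) ∂P) ^ 2 := by
    rw [sq, ← integral_prod_mul]
    rfl
  rw [e₀] at h
  exact h

/-- A centered Gaussian process with a covariance depending on time differences is stationary. -/
theorem isStationaryProcess {X : ℝ → Ω → ℝ} (hX : IsCenteredGaussianProcess X P) {r : ℝ → ℝ}
    (hr : ∀ t s, ∫ ω, X t ω * X s ω ∂P = r (t - s)) : IsStationaryProcess X P := fun h I ↦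
  ⟨aemeasurable_pi_lambda _ fun _ ↦ hX.gaussian.aemeasurable _,
    aemeasurable_pi_lambda _ fun _ ↦ hX.gaussian.aemeasurable _,
    map_eq_of_covariance_eq (hX.comp_right fun i : I ↦ (i + h : ℝ))
      (hX.comp_right fun i : I ↦ (i : ℝ)) fun i j ↦ by
        rw [hr, hr, add_sub_add_right_eq_sub]⟩

end IsCenteredGaussianProcess

end

/-! ### Ergodicity from decay of the covariance. -/

section

variable {Ω : Type*} [MeasurableSpace Ω] {P : Measure Ω}

theorem MeasureTheory.Integrable.abs_sub {α : Type*} [MeasurableSpace α] {μ : Measure α}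
    {f g : α → ℝ} (hf : Integrable f μ) (hg : Integrable g μ) :
    Integrable (fun x ↦ |f x - g x|) μ :=
  (hf.sub hg).abs

theorem exists_continuous_abs_sub_indicator_le {ι : Type*} [Fintype ι] (ν : Measure (ι → ℝ))
    [IsFiniteMeasure ν] {S : Set (ι → ℝ)} (hS : MeasurableSet S) {ε : ℝ} (hε : 0 < ε) :
    ∃ f : (ι → ℝ) → ℝ, Continuous f ∧ (∀ x, |f x| ≤ 1) ∧
      ∫ x, |S.indicator 1 x - f x| ∂ν ≤ ε := by
  have hint : Integrable (S.indicator (1 : (ι → ℝ) → ℝ)) ν :=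
    (integrable_const (1 : ℝ)).indicator hS
  obtain ⟨g, hg, hgi⟩ := hint.exists_boundedContinuous_integral_sub_le hε
  -- Truncation to `[0, 1]` never increases the distance to a function with values `0` and `1`.
  have hc : Continuous fun x ↦ max 0 (min 1 (g x)) := by fun_prop
  have hb (x : ι → ℝ) : |max 0 (min 1 (g x))| ≤ 1 := by
    rw [abs_of_nonneg (le_max_left _ _)]
    exact max_le zero_le_one (min_le_left _ _)
  refine ⟨fun x ↦ max 0 (min 1 (g x)), hc, hb,
    (integral_mono ?_ (hint.sub hgi).norm fun x ↦ ?_).trans hg⟩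
  · refine (hint.sub (Integrable.of_bound hc.aestronglyMeasurable 1
      (Eventually.of_forall hb))).abs
  · simp only [Pi.sub_apply, Real.norm_eq_abs]
    have h01 : S.indicator (1 : (ι → ℝ) → ℝ) x = 0 ∨ S.indicator (1 : (ι → ℝ) → ℝ) x = 1 := by
      by_cases h : x ∈ S <;> simp [h]
    rcases h01 with h | h <;> rw [h] <;> rcases max_cases 0 (min 1 (g x)) with h₁ | h₁ <;>
      rcases min_cases 1 (g x) with h₂ | h₂ <;> rw [h₁.1] <;> first
      | exact abs_le_abs (by linarith) (by linarith)
      | exact abs_le_abs_of_nonpos (by linarith) (by linarith)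

/-- Let `p` be the probability of an invariant event, approximated in `L¹` by a continuous function
`u` of finitely many coordinates. Invariance makes `E[u 0 · u n]` close to `p` for every `n`;
asymptotic independence makes its limit `(E u)²`, which is close to `p²`. Hence `p = p²`. -/
theorem IsCenteredGaussianProcess.isErgodicProcess {X : ℝ → Ω → ℝ}
    (hX : IsCenteredGaussianProcess X P) (hm : ∀ t, Measurable (X t)) {r : ℝ → ℝ}
    (hr : ∀ t s, ∫ ω, X t ω * X s ω ∂P = r (t - s)) (hr0 : Tendsto r atTop (𝓝 0)) :
    IsErgodicProcess X P := by
  classical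
  intro A hA hinv
  have := hX.gaussian.isProbabilityMeasure
  have hXm (h : ℝ) : Measurable fun ω t ↦ X (t + h) ω := measurable_pi_lambda _ fun t ↦ hm _
  have hXm₀ : Measurable fun ω t ↦ X t ω := measurable_pi_lambda _ fun t ↦ hm t
  set μ : Measure (ℝ → ℝ) := P.map fun ω t ↦ X t ω with hμ
  have hprob : IsProbabilityMeasure μ := Measure.isProbabilityMeasure_map hXm₀.aemeasurable
  have hshift (h : ℝ) : P.map (fun ω t ↦ X (t + h) ω) = μ := by
    refine (map_eq_iff_forall_finset_map_restrict_eq (hXm h).aemeasurable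
      hXm₀.aemeasurable).2 fun I ↦ ?_
    exact (hX.isStationaryProcess hr h I).map_eq
  set a : ℝ → Ω → ℝ := fun h ω ↦ A.indicator 1 fun t ↦ X (t + h) ω with ha
  have ha01 (h : ℝ) (ω : Ω) : a h ω = 0 ∨ a h ω = 1 := by
    by_cases hh : (fun t ↦ X (t + h) ω) ∈ A <;> simp [ha, hh]
  have hA1 : Measurable (A.indicator (1 : (ℝ → ℝ) → ℝ)) := measurable_one.indicator hA
  have ham (h : ℝ) : Measurable (a h) := hA1.comp (hXm h)
  have hai (h : ℝ) : Integrable (a h) P :=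
    Integrable.of_bound (ham h).aestronglyMeasurable 1 (Eventually.of_forall fun ω ↦ by
      rcases ha01 h ω with h | h <;> simp [h])
  set p : ℝ := ∫ ω, a 0 ω ∂P with hp
  have hae (h : ℝ) : ∀ᵐ ω ∂P, a h ω = a 0 ω := by
    filter_upwards [hinv h] with ω hω
    by_cases h0 : (fun t ↦ X t ω) ∈ A
    · simp [ha, h0, hω.2 h0]
    · simp [ha, h0, mt hω.1 h0]
  have hp1 : |p| ≤ 1 := by
    have h1 (ω : Ω) : ‖a 0 ω‖ ≤ 1 := by rcases ha01 0 ω with h | h <;> simp [h]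
    simpa using norm_integral_le_of_norm_le_const (μ := P) (Eventually.of_forall h1)
  have key (ε : ℝ) (hε : 0 < ε) : |p ^ 2 - p| ≤ 8 * ε := by
    obtain ⟨s, hs, hsε⟩ := (Measure.MeasureDense.of_generateFrom_isSetAlgebra_finite (μ := μ)
      isSetAlgebra_measurableCylinders generateFrom_measurableCylinders.symm).approx A hA
      (measure_ne_top _ _) ε hε
    obtain ⟨I, S, hS, rfl⟩ := (mem_measurableCylinders s).1 hs
    obtain ⟨f, hfc, hf1, hfS⟩ := exists_continuous_abs_sub_indicator_le
      (μ.map I.restrict) hS hε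
    have hrm : Measurable (I.restrict (π := fun _ : ℝ ↦ ℝ)) := Finset.measurable_restrict _
    have hfm : Measurable fun x : ℝ → ℝ ↦ f (I.restrict x) := hfc.measurable.comp hrm
    have hfi : Integrable (fun x : ℝ → ℝ ↦ f (I.restrict x)) μ :=
      Integrable.of_bound hfm.aestronglyMeasurable 1 (Eventually.of_forall fun x ↦ hf1 _)
    have hAi : Integrable (A.indicator (1 : (ℝ → ℝ) → ℝ)) μ :=
      (integrable_const (1 : ℝ)).indicator hA
    have hCm := MeasurableSet.of_mem_measurableCylinders hs
    have hCi : Integrable ((cylinder I S).indicator (1 : (ℝ → ℝ) → ℝ)) μ :=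
      (integrable_const (1 : ℝ)).indicator hCm
    have happrox : ∫ x, |A.indicator 1 x - f (I.restrict x)| ∂μ ≤ 2 * ε := by
      have h₁ : ∫ x, |A.indicator (1 : (ℝ → ℝ) → ℝ) x - (cylinder I S).indicator 1 x| ∂μ ≤ ε := by
        have e : (fun x ↦ |A.indicator (1 : (ℝ → ℝ) → ℝ) x - (cylinder I S).indicator 1 x|)
            = (symmDiff A (cylinder I S)).indicator 1 := by
          ext x
          by_cases h1 : x ∈ A <;> by_cases h2 : x ∈ cylinder I S <;>
            simp [h1, h2, Set.mem_symmDiff]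
        rw [e, integral_indicator_one (hA.symmDiff hCm)]
        exact ENNReal.toReal_le_of_le_ofReal hε.le hsε.le
      have h₂ : ∫ x, |(cylinder I S).indicator (1 : (ℝ → ℝ) → ℝ) x - f (I.restrict x)| ∂μ ≤ ε := by
        rw [integral_map hrm.aemeasurable (by
          exact ((measurable_one.indicator hS).sub hfc.measurable).abs.aestronglyMeasurable)] at hfS
        exact hfS
      calc ∫ x, |A.indicator 1 x - f (I.restrict x)| ∂μ
          ≤ ∫ x, (|A.indicator (1 : (ℝ → ℝ) → ℝ) x - (cylinder I S).indicator 1 x|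
            + |(cylinder I S).indicator (1 : (ℝ → ℝ) → ℝ) x - f (I.restrict x)|) ∂μ :=
            integral_mono (hAi.abs_sub hfi) ((hAi.abs_sub hCi).add (hCi.abs_sub hfi))
              fun x ↦ abs_sub_le _ _ _
        _ ≤ 2 * ε := by
            rw [integral_add (hAi.abs_sub hCi) (hCi.abs_sub hfi)]
            linarith
    set u : ℝ → Ω → ℝ := fun h ω ↦ f fun i : I ↦ X (i + h) ω with hu
    have hum (h : ℝ) : Measurable (u h) := hfm.comp (hXm h)
    have hu1 (h : ℝ) (ω : Ω) : |u h ω| ≤ 1 := hf1 _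
    have hui (h : ℝ) : Integrable (u h) P :=
      Integrable.of_bound (hum h).aestronglyMeasurable 1 (Eventually.of_forall (hu1 h))
    -- By stationarity one approximation serves all shifts with the same error.
    have hdist (h : ℝ) : ∫ ω, |a h ω - u h ω| ∂P ≤ 2 * ε := by
      have hmeas : Measurable fun x : ℝ → ℝ ↦ |A.indicator 1 x - f (I.restrict x)| :=
        (hA1.sub hfm).abs
      rw [← hshift h, integral_map (hXm h).aemeasurable hmeas.aestronglyMeasurable] at happrox
      exact happrox
    have hmix : Tendsto (fun n : ℕ ↦ ∫ ω, u 0 ω * u n ω ∂P) atTop (𝓝 ((∫ ω, u 0 ω ∂P) ^ 2)) := by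
      refine IsCenteredGaussianProcess.tendsto_integral_mul_of_cross_covariance
        (X := fun i : I ↦ X (i + 0)) (Y := fun (n : ℕ) (i : I) ↦ X (i + n)) (fun n ↦ ?_)
        (fun n i j ↦ ?_) (fun i j ↦ ?_) hfc hf1
      · have := hX.comp_right (Sum.elim (fun i : I ↦ (i : ℝ) + 0) fun i : I ↦ (i : ℝ) + n)
        convert! this using 1
        ext k
        rcases k with k | k <;> rfl
      · rw [hr, hr, add_sub_add_right_eq_sub, add_sub_add_right_eq_sub]
      · have e (n : ℕ) : ∫ ω, X (i + 0) ω * X (j + n) ω ∂P = r (n + (j - i)) := by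
          simp_rw [mul_comm (X (i + 0) _)]
          rw [hr]
          ring_nf
        simp_rw [e]
        exact hr0.comp
          (tendsto_atTop_add_const_right atTop ((j : ℝ) - i) tendsto_natCast_atTop_atTop)
    have hprod (n : ℕ) : |∫ ω, u 0 ω * u n ω ∂P - p| ≤ 4 * ε := by
      have hi₁ : Integrable (fun ω ↦ u 0 ω * u n ω) P :=
        Integrable.of_bound ((hum 0).mul (hum n)).aestronglyMeasurable 1
          (Eventually.of_forall fun ω ↦ by
            rw [Real.norm_eq_abs, abs_mul]
            exact mul_le_one₀ (hu1 _ _) (abs_nonneg _) (hu1 _ _))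
      rw [hp, ← integral_sub hi₁ (hai 0)]
      refine abs_integral_le_integral_abs.trans ?_
      calc ∫ ω, |u 0 ω * u n ω - a 0 ω| ∂P
          ≤ ∫ ω, (|a 0 ω - u 0 ω| + |a n ω - u n ω|) ∂P := by
            refine integral_mono_ae (hi₁.sub (hai 0)).abs
              (((hai 0).abs_sub (hui 0)).add ((hai n).abs_sub (hui n))) ?_
            filter_upwards [hae n] with ω hω
            rw [hω]
            -- Here `a 0` is an indicator, so `(a 0)² = a 0`.
            have e : u 0 ω * u n ω - a 0 ω
                = -(u 0 ω * (a 0 ω - u n ω)) - a 0 ω * (a 0 ω - u 0 ω) := by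
              rcases ha01 0 ω with h | h <;> rw [h] <;> ring
            have ha1 : |a 0 ω| ≤ 1 := by rcases ha01 0 ω with h | h <;> simp [h]
            rw [e]
            refine (abs_sub _ _).trans ?_
            rw [abs_neg, abs_mul, abs_mul, add_comm]
            exact add_le_add (mul_le_of_le_one_left (abs_nonneg _) ha1)
              (mul_le_of_le_one_left (abs_nonneg _) (hu1 0 ω))
        _ ≤ 4 * ε := by
            rw [integral_add ((hai 0).abs_sub (hui 0)) ((hai n).abs_sub (hui n))]
            linarith [hdist 0, hdist n]
    have hlim : |(∫ ω, u 0 ω ∂P) ^ 2 - p| ≤ 4 * ε :=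
      le_of_tendsto' (hmix.sub_const p).abs hprod
    have hmean : |p - ∫ ω, u 0 ω ∂P| ≤ 2 * ε := by
      rw [hp, ← integral_sub (hai 0) (hui 0)]
      exact abs_integral_le_integral_abs.trans (hdist 0)
    have hU1 : |∫ ω, u 0 ω ∂P| ≤ 1 := by
      simpa using norm_integral_le_of_norm_le_const (μ := P) (f := u 0)
        (Eventually.of_forall (hu1 0))
    have hsq : |p ^ 2 - (∫ ω, u 0 ω ∂P) ^ 2| ≤ 4 * ε := by
      rw [sq_sub_sq, abs_mul]
      have h2 : |p + ∫ ω, u 0 ω ∂P| ≤ 2 := (abs_add_le _ _).trans (by linarith)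
      nlinarith [abs_nonneg (p - ∫ ω, u 0 ω ∂P)]
    linarith [abs_sub_le (p ^ 2) ((∫ ω, u 0 ω ∂P) ^ 2) p]
  have hpp : p ^ 2 - p = 0 := by
    by_contra h
    have h0 := abs_pos.2 h
    have := key (|p ^ 2 - p| / 16) (by positivity)
    linarith
  have hpA : p = P.real {ω | (fun t ↦ X t ω) ∈ A} := by
    have e : a 0 = ({ω | (fun t ↦ X t ω) ∈ A}).indicator 1 := by
      ext ω
      simp [ha, Set.indicator_apply]
    have hmeas : MeasurableSet {ω | (fun t ↦ X t ω) ∈ A} := hXm₀ hA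
    rw [hp, e, integral_indicator_one hmeas]
  have hp01 : p = 0 ∨ p = 1 := by
    rcases mul_eq_zero.1 (show p * (p - 1) = 0 by linarith) with h | h
    · exact Or.inl h
    · exact Or.inr (by linarith)
  rcases hp01 with h | h
  · right
    rw [hpA, measureReal_eq_zero_iff] at h
    exact measure_eq_zero_iff_ae_notMem.1 h
  · left
    rw [hpA] at h
    have h1 : P {ω | (fun t ↦ X t ω) ∈ A} = 1 := by
      rw [← ENNReal.ofReal_one, ← h, ofReal_measureReal]
    exact (mem_ae_iff_prob_eq_one (hXm₀ hA)).2 h1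

end

/-! ### The two processes over an arbitrary fractional Brownian motion. -/

section

variable {Ω : Type*} [MeasurableSpace Ω] {P : Measure Ω} {H θ : ℝ} {B : ℝ → Ω → ℝ}

theorem IsErgodicProcess.congr {X Y : ℝ → Ω → ℝ} (hX : IsErgodicProcess X P)
    (h : ∀ᵐ ω ∂P, ∀ t, X t ω = Y t ω) : IsErgodicProcess Y P := by
  have hs : ∀ᵐ ω ∂P, ∀ s : ℝ, (fun t ↦ X (t + s) ω) = fun t ↦ Y (t + s) ω :=
    h.mono fun ω hω s ↦ funext fun t ↦ hω _
  have h0 : ∀ᵐ ω ∂P, (fun t ↦ X t ω) = fun t ↦ Y t ω := h.mono fun ω hω ↦ funext hω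
  intro A hA hinv
  refine (hX A hA fun s ↦ ?_).imp (fun hh ↦ ?_) fun hh ↦ ?_
  · filter_upwards [hinv s, hs, h0] with ω h₁ h₂ h₃
    rw [h₂, h₃]
    exact h₁
  · filter_upwards [hh, h0] with ω h₁ h₂
    rwa [← h₂]
  · filter_upwards [hh, h0] with ω h₁ h₂
    rwa [← h₂]

theorem measurable_fouZ (hθ : 0 < θ) (hm : ∀ t, Measurable (B t))
    (hc : ∀ ω, Continuous fun t ↦ B t ω)
    (hgr : ∀ ω, (fun s ↦ B s ω) =O[atBot] fun s ↦ Real.exp (-(θ / 2) * s)) (t : ℝ) :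
    Measurable (fouZ θ B t) := by
  have e : fouZ θ B t = fun ω ↦ θ * ∫ u in Set.Ioi (0 : ℝ),
      Real.exp (-θ * u) * (B t ω - B (t - u) ω) :=
    funext fun ω ↦ (hasRSIntegralIic_exp_sub hθ (hc ω) (hgr ω) t).rsIntegralIic_eq
  have hBm : Measurable (Function.uncurry B) :=
    measurable_uncurry_of_continuous_of_measurable hc hm
  have h₁ : Measurable fun z : Ω × ℝ ↦ Real.exp (-θ * z.2) * (B t z.1 - B (t - z.2) z.1) :=
    (by fun_prop : Measurable fun z : Ω × ℝ ↦ Real.exp (-θ * z.2)).mul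
      (((hm t).comp measurable_fst).sub
        (hBm.comp ((measurable_const.sub measurable_snd).prodMk measurable_fst)))
  rw [e]
  exact (h₁.stronglyMeasurable.integral_prod_right (ν := volume.restrict (Set.Ioi 0))).measurable.const_mul θ

namespace IsFractionalBrownianMotion

theorem ae_exists_integrals (hB : IsFractionalBrownianMotion H B P) (hH : 0 < H) (hθ : 0 < θ) :
    ∀ᵐ ω ∂P,
      (∀ t ≥ 0, ∃ I, HasRSIntegral (fun s ↦ Real.exp (θ * s)) (fun s ↦ B s ω) 0 t I) ∧
      ∀ t, ∃ I, HasRSIntegralIic (fun s ↦ Real.exp (-θ * (t - s))) (fun s ↦ B s ω) t I := by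
  filter_upwards [hB.continuous_paths, hB.ae_isBigO_exp hH (half_pos hθ)] with ω hc hgr
  exact ⟨fun t ht ↦ ⟨_, hasRSIntegral_exp hc θ ht⟩,
    fun t ↦ ⟨_, hasRSIntegralIic_exp_sub hθ hc hgr t⟩⟩

theorem fouX_ae_eq (hB : IsFractionalBrownianMotion H B P) (hH : 0 < H) (hθ : 0 < θ) {t : ℝ}
    (ht : 0 ≤ t) :
    fouX θ B t =ᵐ[P] fun ω ↦ fouZ θ B t ω - Real.exp (-θ * t) * fouZ θ B 0 ω := by
  filter_upwards [hB.continuous_paths, hB.ae_isBigO_exp hH (half_pos hθ)] with ω hc hgr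
  exact exp_mul_rsIntegral_eq hθ hc hgr ht

/-- The results for the regular version transfer because `fouZ` is a functional of the path: where
the paths agree, so do the integrals at all times. -/
theorem fouZ_spec (hB : IsFractionalBrownianMotion H B P) (hH₀ : 0 < H) (hH₁ : H < 1)
    (hθ : 0 < θ) :
    IsCenteredGaussianProcess (fouZ θ B) P ∧
      (∀ t s, ∫ ω, fouZ θ B t ω * fouZ θ B s ω ∂P = fouCov H θ (t - s)) ∧
      IsErgodicProcess (fouZ θ B) P := by
  obtain ⟨B', hB', hm, hc, hgr, hae⟩ := hB.exists_regular_version hH₀ (half_pos hθ)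
  have hZ' := isCenteredGaussianProcess_fouZ hθ hB'.isCenteredGaussianProcess hc hgr
  have hcov := hB'.integral_fouZ_mul_fouZ hH₀ hθ hm hc hgr
  have heq : ∀ᵐ ω ∂P, ∀ t, fouZ θ B' t ω = fouZ θ B t ω := by
    filter_upwards [hae] with ω hω t
    simp_rw [fouZ, hω]
  have heqt (t : ℝ) : fouZ θ B' t =ᵐ[P] fouZ θ B t := heq.mono fun ω h ↦ h t
  refine ⟨hZ'.congr heqt, fun t s ↦ ?_, (hZ'.isErgodicProcess (measurable_fouZ hθ hm hc hgr) hcov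
    (tendsto_fouCov_atTop hH₀ hH₁ hθ)).congr heq⟩
  rw [← hcov]
  exact integral_congr_ae ((heqt t).symm.mul (heqt s).symm)

theorem hasGaussianLaw_fouX (hB : IsFractionalBrownianMotion H B P) (hH₀ : 0 < H) (hH₁ : H < 1)
    (hθ : 0 < θ) {t : ℝ} (ht : 0 ≤ t) : HasGaussianLaw (fouX θ B t) P := by
  have hZ := (hB.fouZ_spec hH₀ hH₁ hθ).1
  have h := (hZ.gaussian.hasGaussianLaw_prodMk (s := t) (t := 0)).map_fun
    (ContinuousLinearMap.fst ℝ ℝ ℝ - Real.exp (-θ * t) • ContinuousLinearMap.snd ℝ ℝ ℝ)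
  refine h.congr ?_
  filter_upwards [hB.fouX_ae_eq hH₀ hθ ht] with ω hω
  simp [hω]

theorem integral_fouX (hB : IsFractionalBrownianMotion H B P) (hH₀ : 0 < H) (hH₁ : H < 1)
    (hθ : 0 < θ) {t : ℝ} (ht : 0 ≤ t) : ∫ ω, fouX θ B t ω ∂P = 0 := by
  have hZ := (hB.fouZ_spec hH₀ hH₁ hθ).1
  rw [integral_congr_ae (hB.fouX_ae_eq hH₀ hθ ht),
    integral_sub (hZ.integrable t) ((hZ.integrable 0).const_mul _), integral_const_mul,
    hZ.centered, hZ.centered]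
  simp

theorem integral_fouX_mul_fouX (hB : IsFractionalBrownianMotion H B P) (hH₀ : 0 < H) (hH₁ : H < 1)
    (hθ : 0 < θ) {t s : ℝ} (ht : 0 ≤ t) (hs : 0 ≤ s) :
    ∫ ω, fouX θ B t ω * fouX θ B s ω ∂P = fouCov H θ (t - s) - Real.exp (-θ * s) * fouCov H θ t
      - Real.exp (-θ * t) * fouCov H θ s
      + Real.exp (-θ * t) * Real.exp (-θ * s) * fouCov H θ 0 := by
  obtain ⟨hZ, hcov, -⟩ := hB.fouZ_spec hH₀ hH₁ hθ
  have hint (c a b : ℝ) : Integrable (fun ω ↦ c * (fouZ θ B a ω * fouZ θ B b ω)) P :=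
    ((hZ.memLp_two a).integrable_mul (hZ.memLp_two b)).const_mul c
  have e : (fun ω ↦ fouX θ B t ω * fouX θ B s ω) =ᵐ[P] fun ω ↦
      (1 * (fouZ θ B t ω * fouZ θ B s ω) - Real.exp (-θ * s) * (fouZ θ B t ω * fouZ θ B 0 ω))
      - (Real.exp (-θ * t) * (fouZ θ B 0 ω * fouZ θ B s ω)
        - Real.exp (-θ * t) * Real.exp (-θ * s) * (fouZ θ B 0 ω * fouZ θ B 0 ω)) := by
    filter_upwards [hB.fouX_ae_eq hH₀ hθ ht, hB.fouX_ae_eq hH₀ hθ hs] with ω h₁ h₂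
    rw [h₁, h₂]
    ring
  have hint₂ (c d a b a' b' : ℝ) : Integrable (fun ω ↦ c * (fouZ θ B a ω * fouZ θ B b ω)
      - d * (fouZ θ B a' ω * fouZ θ B b' ω)) P := (hint c a b).sub (hint d a' b')
  rw [integral_congr_ae e, integral_sub (hint₂ _ _ _ _ _ _) (hint₂ _ _ _ _ _ _),
    integral_sub (hint _ _ _) (hint _ _ _), integral_sub (hint _ _ _) (hint _ _ _)]
  simp_rw [integral_const_mul, hcov]
  rw [zero_sub, fouCov_neg, sub_zero, sub_zero]
  ring

/-- A covariance function is maximal at zero: `|xy| ≤ (x² + y²)/2` together with stationarity. -/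
theorem abs_fouCov_le (hB : IsFractionalBrownianMotion H B P) (hH₀ : 0 < H) (hH₁ : H < 1)
    (hθ : 0 < θ) (t : ℝ) : |fouCov H θ t| ≤ fouCov H θ 0 := by
  obtain ⟨hZ, hcov, -⟩ := hB.fouZ_spec hH₀ hH₁ hθ
  have hi (a b : ℝ) : Integrable (fun ω ↦ fouZ θ B a ω * fouZ θ B b ω) P :=
    (hZ.memLp_two a).integrable_mul (hZ.memLp_two b)
  have h₁ : ∫ ω, |fouZ θ B t ω * fouZ θ B 0 ω| ∂P
      ≤ ∫ ω, 1 / 2 * (fouZ θ B t ω * fouZ θ B t ω + fouZ θ B 0 ω * fouZ θ B 0 ω) ∂P := by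
    refine integral_mono (hi t 0).abs (((hi t t).add (hi 0 0)).const_mul _) fun ω ↦ ?_
    simp only
    rw [abs_mul]
    nlinarith [sq_nonneg (|fouZ θ B t ω| - |fouZ θ B 0 ω|), abs_mul_abs_self (fouZ θ B t ω),
      abs_mul_abs_self (fouZ θ B 0 ω)]
  rw [integral_const_mul, integral_add (hi t t) (hi 0 0), hcov, hcov, sub_self, sub_self] at h₁
  have h₂ : |fouCov H θ t| ≤ ∫ ω, |fouZ θ B t ω * fouZ θ B 0 ω| ∂P := by
    have := hcov t 0
    rw [sub_zero] at this
    rw [← this]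
    exact abs_integral_le_integral_abs
  linarith

/-- Even moments are constants times powers of the variance, and `|x^k - y^k| ≤ |x - y| k
max(|x|,|y|)^{k-1}`. With `E = e^{-θt}` and `r = fouCov`, the variances differ by `-2E r(t) + E²
r(0)`, at most `3 r(0) E` in modulus, and both are at most `4 r(0)`. -/
theorem abs_moment_fouX_sub_le (hB : IsFractionalBrownianMotion H B P) (hH₀ : 0 < H) (hH₁ : H < 1)
    (hθ : 0 < θ) (k : ℕ) {t : ℝ} (ht : 0 ≤ t) :
    |∫ ω, fouX θ B t ω ^ (2 * k) ∂P - ∫ ω, fouZ θ B 0 ω ^ (2 * k) ∂P|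
      ≤ ((2 * k)! : ℝ) / (2 ^ k * (k ! : ℝ)) *
        (3 * fouCov H θ 0 * k * (4 * fouCov H θ 0) ^ (k - 1)) * Real.exp (-θ * t) := by
  obtain ⟨hZ, hcov, -⟩ := hB.fouZ_spec hH₀ hH₁ hθ
  rw [integral_pow_two_mul_of_hasGaussianLaw (hB.hasGaussianLaw_fouX hH₀ hH₁ hθ ht)
    (hB.integral_fouX hH₀ hH₁ hθ ht), integral_pow_two_mul_of_hasGaussianLaw
    (hZ.gaussian.hasGaussianLaw_eval 0) (hZ.centered 0)]
  have hX2 := hB.integral_fouX_mul_fouX hH₀ hH₁ hθ ht ht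
  have hZ2 := hcov 0 0
  simp_rw [← sq, sub_self] at hX2 hZ2
  rw [← mul_sub, abs_mul, hX2, hZ2, abs_of_nonneg (by positivity :
    (0 : ℝ) ≤ ((2 * k)! : ℝ) / (2 ^ k * (k ! : ℝ))), mul_assoc]
  refine mul_le_mul_of_nonneg_left ?_ (by positivity)
  have hv0 : 0 ≤ fouCov H θ 0 - Real.exp (-θ * t) * fouCov H θ t
      - Real.exp (-θ * t) * fouCov H θ t + Real.exp (-θ * t) ^ 2 * fouCov H θ 0 := by
    rw [← hX2]
    exact integral_nonneg fun ω ↦ sq_nonneg _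
  have hr := hB.abs_fouCov_le hH₀ hH₁ hθ t
  have hr' := abs_le.1 hr
  have hr0 : 0 ≤ fouCov H θ 0 := (abs_nonneg _).trans hr
  set E := Real.exp (-θ * t) with hE
  have hE0 : 0 < E := Real.exp_pos _
  have hE1 : E ≤ 1 := Real.exp_le_one_iff.2 (by nlinarith)
  have hEr : |E * fouCov H θ t| ≤ E * fouCov H θ 0 := by
    rw [abs_mul, abs_of_pos hE0]
    gcongr
  have hEr' := abs_le.1 hEr
  have hEE : E ^ 2 * fouCov H θ 0 ≤ E * fouCov H θ 0 := by
    gcongr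
    nlinarith
  have hEE' : E * fouCov H θ 0 ≤ fouCov H θ 0 := mul_le_of_le_one_left hr0 hE1
  have hEE0 : 0 ≤ E ^ 2 * fouCov H θ 0 := by positivity
  refine (abs_pow_sub_pow_le _ _ _).trans ?_
  have h₁ : |fouCov H θ 0 - E * fouCov H θ t - E * fouCov H θ t + E ^ 2 * fouCov H θ 0
      - fouCov H θ 0| ≤ 3 * fouCov H θ 0 * E := by
    rw [abs_le]
    constructor <;> linarith
  have h₂ : max |fouCov H θ 0 - E * fouCov H θ t - E * fouCov H θ t + E ^ 2 * fouCov H θ 0|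
      |fouCov H θ 0| ≤ 4 * fouCov H θ 0 := by
    rw [abs_of_nonneg hv0, abs_of_nonneg hr0]
    exact max_le (by linarith) (by linarith)
  have h₃ : 0 ≤ max |fouCov H θ 0 - E * fouCov H θ t - E * fouCov H θ t + E ^ 2 * fouCov H θ 0|
      |fouCov H θ 0| := (abs_nonneg _).trans (le_max_right _ _)
  calc _ ≤ 3 * fouCov H θ 0 * E * k * (4 * fouCov H θ 0) ^ (k - 1) := by gcongr
    _ = _ := by ring

end IsFractionalBrownianMotion

theorem exp_neg_mul_le_rpow (hH₀ : 0 < H) (hθ : 0 < θ) {u : ℝ} (hu : 1 ≤ u) :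
    Real.exp (-θ * u) ≤ 2 / θ ^ 2 * u ^ (2 * H - 2) := by
  have h₁ : (θ * u) ^ 2 / 2 ≤ Real.exp (θ * u) := by
    have := Real.pow_div_factorial_le_exp (θ * u) (by positivity) 2
    simpa using this
  have h₂ : u ^ (-2 : ℝ) ≤ u ^ (2 * H - 2) := Real.rpow_le_rpow_of_exponent_le hu (by linarith)
  calc Real.exp (-θ * u) = (Real.exp (θ * u))⁻¹ := by rw [← Real.exp_neg, neg_mul]
    _ ≤ ((θ * u) ^ 2 / 2)⁻¹ := inv_anti₀ (by positivity) h₁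
    _ = 2 / θ ^ 2 * u ^ (-2 : ℝ) := by
        rw [Real.rpow_neg (by linarith), Real.rpow_two]
        field_simp
    _ ≤ _ := by gcongr

/-- With `s ≤ t`, the terms in `fouCov (t - s)` and `fouCov t` obey the power bound, as `t ≥ t - s`.
The other two carry `e^{-θt} ≤ e^{-θ(t-s)}`, which the power dominates; there `fouCov s` is bounded
by `fouCov 0`, since `s` may be close to zero. -/
theorem fouX_cov_le_rpow (hH₀ : 0 < H) (hH₁ : H < 1) (hθ : 0 < θ) {K : ℝ} (hK0 : 0 ≤ K)
    (hK : ∀ t > 0, |fouCov H θ t| ≤ K * t ^ (2 * H - 2))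
    (hB : IsFractionalBrownianMotion H B P) {t s : ℝ} (ht : 0 ≤ t) (hs : 0 ≤ s)
    (hts : 2 < |t - s|) :
    ∫ ω, fouX θ B t ω * fouX θ B s ω ∂P
      ≤ (2 * K + 2 * fouCov H θ 0 * (2 / θ ^ 2)) * |t - s| ^ (2 * H - 2) := by
  wlog h : s ≤ t generalizing t s
  · rw [abs_sub_comm] at hts ⊢
    simp_rw [mul_comm (fouX θ B t _)]
    exact this hs ht hts (le_of_not_ge h)
  rw [abs_of_nonneg (sub_nonneg.2 h)] at hts ⊢
  rw [hB.integral_fouX_mul_fouX hH₀ hH₁ hθ ht hs]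
  have h₁ := (abs_le.1 (hK (t - s) (by linarith))).2
  have h₂ := (abs_le.1 (hK t (by linarith))).1
  have h₃ := hB.abs_fouCov_le hH₀ hH₁ hθ s
  have h₀ : 0 ≤ fouCov H θ 0 := (abs_nonneg _).trans h₃
  have h₃' := (abs_le.1 h₃).1
  have h₄ := exp_neg_mul_le_rpow hH₀ hθ (by linarith : 1 ≤ t - s)
  have h₅ : t ^ (2 * H - 2) ≤ (t - s) ^ (2 * H - 2) :=
    Real.rpow_le_rpow_of_nonpos (by linarith) (by linarith) (by linarith)
  have h₆ : Real.exp (-θ * t) ≤ Real.exp (-θ * (t - s)) := Real.exp_le_exp.2 (by nlinarith)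
  have hEs : Real.exp (-θ * s) ≤ 1 := Real.exp_le_one_iff.2 (by nlinarith)
  have hEs0 := Real.exp_pos (-θ * s)
  have hEt0 := Real.exp_pos (-θ * t)
  set q := (t - s) ^ (2 * H - 2) with hq
  have hq0 : 0 ≤ q := Real.rpow_nonneg (by linarith) _
  have g₁ : -(Real.exp (-θ * s) * fouCov H θ t) ≤ K * q := by
    have : -fouCov H θ t ≤ K * q := by nlinarith
    have hKq : 0 ≤ K * q := by positivity
    nlinarith
  have g₂ : -(Real.exp (-θ * t) * fouCov H θ s) ≤ Real.exp (-θ * t) * fouCov H θ 0 := by nlinarith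
  have g₃ : Real.exp (-θ * t) * Real.exp (-θ * s) * fouCov H θ 0
      ≤ Real.exp (-θ * t) * fouCov H θ 0 := by
    gcongr
    exact mul_le_of_le_one_right hEt0.le hEs
  have g₄ : Real.exp (-θ * t) * fouCov H θ 0 ≤ 2 / θ ^ 2 * q * fouCov H θ 0 := by
    gcongr
    exact h₆.trans h₄
  linarith

/-- The four terms combine to `(e^{-θ|t-s|} - e^{-θ(t+s)})/(2θ)`. -/
theorem fouX_cov_le_exp (hθ : 0 < θ) (hB : IsFractionalBrownianMotion (1 / 2) B P) {t s : ℝ}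
    (ht : 0 ≤ t) (hs : 0 ≤ s) :
    ∫ ω, fouX θ B t ω * fouX θ B s ω ∂P ≤ 1 / (2 * θ) * Real.exp (-θ * |t - s|) := by
  rw [hB.integral_fouX_mul_fouX (by norm_num) (by norm_num) hθ ht hs, ← fouCov_abs (t - s),
    fouCov_half hθ (abs_nonneg _), fouCov_half hθ ht, fouCov_half hθ hs, fouCov_half hθ le_rfl]
  have hE : 0 ≤ Real.exp (-θ * t) * Real.exp (-θ * s) / (2 * θ) := by positivity
  rw [mul_zero, Real.exp_zero]
  have e₁ : Real.exp (-θ * s) * (Real.exp (-θ * t) / (2 * θ))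
      = Real.exp (-θ * t) * Real.exp (-θ * s) / (2 * θ) := by ring
  have e₂ : Real.exp (-θ * t) * (Real.exp (-θ * s) / (2 * θ))
      = Real.exp (-θ * t) * Real.exp (-θ * s) / (2 * θ) := by ring
  have e₃ : Real.exp (-θ * t) * Real.exp (-θ * s) * (1 / (2 * θ))
      = Real.exp (-θ * t) * Real.exp (-θ * s) / (2 * θ) := by ring
  have e₄ : 1 / (2 * θ) * Real.exp (-θ * |t - s|) = Real.exp (-θ * |t - s|) / (2 * θ) := by ring
  rw [e₁, e₂, e₃, e₄]
  linarith

end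

/-! ### The main theorem. -/

theorem theorem3p2 (H θ : ℝ) (hH₀ : 0 < H) (hH₁ : H < 1) (hθ : 0 < θ) :
    -- the constants of (ii) and (iv): they depend only on `θ`, `H` and (in (ii)) on `p`
    ∃ (C : ℕ → ℝ) (K : ℝ), (∀ p, 0 < C p) ∧ 0 < K ∧
    ∀ {Ω : Type*} [MeasurableSpace Ω] (P : Measure Ω) [IsProbabilityMeasure P] (B : ℝ → Ω → ℝ),
      IsFractionalBrownianMotion H B P →
      -- the pathwise integrals exist, and the two processes have moments of all orders
      (∀ᵐ ω ∂P,
        (∀ t ≥ 0, ∃ I, HasRSIntegral (fun s ↦ Real.exp (θ * s)) (fun s ↦ B s ω) 0 t I) ∧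
        (∀ t, ∃ I, HasRSIntegralIic (fun s ↦ Real.exp (-θ * (t - s))) (fun s ↦ B s ω) t I)) ∧
      (∀ p : ℕ, (∀ t ≥ 0, MemLp (fouX θ B t) p P) ∧ ∀ t, MemLp (fouZ θ B t) p P) ∧
      -- (i)
      (IsGaussianProcess (fouZ θ B) P ∧ IsStationaryProcess (fouZ θ B) P ∧
        IsErgodicProcess (fouZ θ B) P) ∧
      -- (ii)
      (∀ p : ℕ, 1 ≤ p →
        (Even p →
          (∀ t ≥ 0, |∫ ω, fouX θ B t ω ^ p ∂P - ∫ ω, fouZ θ B 0 ω ^ p ∂P|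
            ≤ C p * Real.exp (-θ * t)) ∧
          ∫ ω, fouZ θ B 0 ω ^ p ∂P = (p ! : ℝ) / (2 ^ (p / 2) * ((p / 2)! : ℝ)) *
            (H * Real.Gamma (2 * H) / θ ^ (2 * H)) ^ (p / 2)) ∧
        (Odd p →
          (∀ t ≥ 0, ∫ ω, fouX θ B t ω ^ p ∂P = 0) ∧ ∫ ω, fouZ θ B 0 ω ^ p ∂P = 0)) ∧
      -- (iii)
      (H ≠ 1 / 2 → Tendsto (fun t ↦ (∫ ω, fouZ θ B t ω * fouZ θ B 0 ω ∂P) /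
        (H * (2 * H - 1) * t ^ (2 * H - 2) / θ ^ 2)) atTop (𝓝 1)) ∧
      (H = 1 / 2 → ∀ t ≥ 0,
        ∫ ω, fouZ θ B t ω * fouZ θ B 0 ω ∂P = Real.exp (-θ * t) / (2 * θ)) ∧
      -- (iv)
      (H ≠ 1 / 2 → ∀ t ≥ 0, ∀ s ≥ 0, 2 < |t - s| →
        ∫ ω, fouX θ B t ω * fouX θ B s ω ∂P ≤ K * |t - s| ^ (2 * H - 2)) ∧
      (H = 1 / 2 → ∀ t ≥ 0, ∀ s ≥ 0, 2 < |t - s| →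
        ∫ ω, fouX θ B t ω * fouX θ B s ω ∂P ≤ K * Real.exp (-θ * |t - s|)) := by
  obtain ⟨K, hK0, hK⟩ := exists_abs_fouCov_le hH₀ hH₁ hθ
  have hΓ : 0 < fouCov H θ 0 := by
    rw [fouCov_zero hH₀ hθ]
    have := Real.Gamma_pos_of_pos (by linarith : 0 < 2 * H)
    positivity
  -- The summand `1` keeps the constant positive when `p / 2 = 0`, where the product vanishes. The
  -- second constant adds those of the cases `H ≠ 1/2` and `H = 1/2`.
  refine ⟨fun p ↦ (p ! : ℝ) / (2 ^ (p / 2) * ((p / 2)! : ℝ)) *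
      (3 * fouCov H θ 0 * (p / 2 : ℕ) * (4 * fouCov H θ 0) ^ (p / 2 - 1)) + 1,
    2 * K + 2 * fouCov H θ 0 * (2 / θ ^ 2) + 1 / (2 * θ), fun p ↦ by positivity, by positivity, ?_⟩
  intro Ω _ P _ B hB
  obtain ⟨hZ, hcov, herg⟩ := hB.fouZ_spec hH₀ hH₁ hθ
  have hX {t : ℝ} (ht : 0 ≤ t) := hB.hasGaussianLaw_fouX hH₀ hH₁ hθ ht
  have hX0 {t : ℝ} (ht : 0 ≤ t) := hB.integral_fouX hH₀ hH₁ hθ ht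
  have hcov0 (t : ℝ) : ∫ ω, fouZ θ B t ω * fouZ θ B 0 ω ∂P = fouCov H θ t := by
    rw [hcov, sub_zero]
  have hZ0 := hZ.gaussian.hasGaussianLaw_eval 0
  refine ⟨hB.ae_exists_integrals hH₀ hθ, fun p ↦ ⟨fun t ht ↦ (hX ht).memLp (ENNReal.natCast_ne_top p),
    fun t ↦ (hZ.gaussian.hasGaussianLaw_eval t).memLp (ENNReal.natCast_ne_top p)⟩,
    ⟨hZ.gaussian, hZ.isStationaryProcess hcov, herg⟩, fun p _ ↦ ⟨fun hp ↦ ?_, fun hp ↦ ?_⟩,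
    fun hH ↦ ?_, fun hH t ht ↦ ?_, fun _ t ht s hs hts ↦ ?_, fun hH t ht s hs _ ↦ ?_⟩
  · obtain ⟨k, rfl⟩ := hp.two_dvd
    rw [Nat.mul_div_cancel_left k two_pos]
    refine ⟨fun t ht ↦ (hB.abs_moment_fouX_sub_le hH₀ hH₁ hθ k ht).trans ?_, ?_⟩
    · simp only [Nat.mul_div_cancel_left k two_pos]
      exact mul_le_mul_of_nonneg_right (by linarith) (Real.exp_pos _).le
    · rw [integral_pow_two_mul_of_hasGaussianLaw hZ0 (hZ.centered 0)]
      simp_rw [sq]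
      rw [hcov0, fouCov_zero hH₀ hθ]
  · obtain ⟨k, rfl⟩ := hp
    exact ⟨fun t ht ↦ integral_pow_two_mul_add_one_of_hasGaussianLaw (hX ht) (hX0 ht) k,
      integral_pow_two_mul_add_one_of_hasGaussianLaw hZ0 (hZ.centered 0) k⟩
  · simp_rw [hcov0]
    have hne : H * (2 * H - 1) / θ ^ 2 ≠ 0 := by
      have : 2 * H - 1 ≠ 0 := fun h ↦ hH (by linarith)
      positivity
    have h := (tendsto_rpow_mul_fouCov hH₀ hH₁ hθ).div_const (H * (2 * H - 1) / θ ^ 2)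
    rw [div_self hne] at h
    refine h.congr fun t ↦ ?_
    rw [div_div]
    congr 1
    ring
  · rw [hcov0, hH, fouCov_half hθ ht]
  · refine (fouX_cov_le_rpow hH₀ hH₁ hθ hK0 hK hB ht hs hts).trans ?_
    refine mul_le_mul_of_nonneg_right ?_ (Real.rpow_nonneg (abs_nonneg _) _)
    linarith [show 0 < 1 / (2 * θ) by positivity]
  · subst hH
    refine (fouX_cov_le_exp hθ hB ht hs).trans ?_
    gcongr
    linarith [show 0 ≤ 2 * K + 2 * fouCov (1 / 2) θ 0 * (2 / θ ^ 2) by positivity]
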